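/- Let $\mathcal{B}_2$ be the gate set consisting of all single-qubit unitary gates and the CNOT gate. A quantum circuit over $\mathcal{B}_2$ is a sequence of layers, each consisting of gates from $\mathcal{B}_2$ that act on pairwise disjoint sets of qubits; its depth is the number of layers and its size is the total number of gates. For a single-qubit unitary $U$, let $\mathrm{C}^nU$ be the gate with $n$ control qubits and one target qubit that applies $U$ to the target if all control qubits are at $|1\rangle$, and acts as the identity otherwise. A circuit on $n+2$ qubits implements $\mathrm{C}^nU$ with one clean ancillary qubit if it maps $|\psi\rangle\otimes|0\rangle$ to $(\mathrm{C}^nU|\psi\rangle)\otimes|0\rangle$ for every state $|\psi\rangle$ of the $n+1$ control and target qubits, where the last factor is the ancillary qubit. There are functions $D,S:\mathbb{N}\to\mathbb{N}$ with $D(n)=O(\log n)$ and $S(n)=O(n)$ as $n\to\infty$ such that for every $n\ge 0$ and every single-qubit unitary $U$, the gate $\mathrm{C}^nU$ is implemented exactly, with one clean ancillary qubit, by a quantum circuit over $\mathcal{B}_2$ of depth at most $D(n)$ and size at most $S(n)$. -/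

import Mathlib

open Filter Asymptotics

namespace QCircuit

/-- The computational basis of a register whose qubits are labelled by `ι` is `ι → Fin 2`, and
operators on the register are matrices indexed by that basis: the entry at `(y, x)` is the
amplitude of `|y⟩` in the image of `|x⟩`. This is the controlled gate that applies `U` to the qubit
`t` if all the qubits in `c` are at `|1⟩`, and the identity otherwise. -/
noncomputable def controlled {ι : Type*} [Fintype ι] [DecidableEq ι]
    (c : Finset ι) (t : ι) (U : Matrix (Fin 2) (Fin 2) ℂ) :
    Matrix (ι → Fin 2) (ι → Fin 2) ℂ :=
  Matrix.of fun y x =>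
    if ∀ j, j ≠ t → y j = x j then
      if ∀ i ∈ c, x i = 1 then U (y t) (x t) else (1 : Matrix (Fin 2) (Fin 2) ℂ) (y t) (x t)
    else 0

/-- The gate `CⁿU` on the qubits `0, …, n` : the qubits `0, …, n - 1` are the controls and the last
qubit is the target. -/
noncomputable def multiControlled (n : ℕ) (U : Matrix (Fin 2) (Fin 2) ℂ) :
    Matrix (Fin (n + 1) → Fin 2) (Fin (n + 1) → Fin 2) ℂ :=
  controlled (Finset.univ.erase (Fin.last n)) (Fin.last n) U

/-- The gate set `B₂`, placed on qubits labelled by `ι` : all single-qubit unitaries, and CNOT. -/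
inductive Gate (ι : Type*) where
  /-- The single-qubit unitary `U` on the qubit `t`. -/
  | single (t : ι) (U : Matrix.unitaryGroup (Fin 2) ℂ) : Gate ι
  /-- CNOT with control `c` and target `t`. -/
  | cnot (c t : ι) (h : c ≠ t) : Gate ι

/-- The set of qubits on which a gate acts. -/
def Gate.qubits {ι : Type*} [DecidableEq ι] : Gate ι → Finset ι
  | .single t _ => {t}
  | .cnot c t _ => {c, t}

/-- The operator of a gate on the whole register. -/
noncomputable def Gate.toMatrix {ι : Type*} [Fintype ι] [DecidableEq ι] :
    Gate ι → Matrix (ι → Fin 2) (ι → Fin 2) ℂ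
  | .single t U => controlled ∅ t (U : Matrix (Fin 2) (Fin 2) ℂ)
  | .cnot c t _ => controlled {c} t !![0, 1; 1, 0]

/-- A quantum circuit over `B₂` : a sequence of layers (the first layer is performed first), each
consisting of gates that act on pairwise disjoint sets of qubits. -/
structure Circuit (ι : Type*) [DecidableEq ι] where
  layers : List (List (Gate ι))
  disjoint : ∀ L ∈ layers, L.Pairwise fun g h => Disjoint g.qubits h.qubits

/-- The depth of a circuit is its number of layers. -/
def Circuit.depth {ι : Type*} [DecidableEq ι] (C : Circuit ι) : ℕ :=
  C.layers.length

/-- The size of a circuit is its number of gates. -/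
def Circuit.size {ι : Type*} [DecidableEq ι] (C : Circuit ι) : ℕ :=
  (C.layers.map List.length).sum

/-- The operator that a circuit performs on its register. -/
noncomputable def Circuit.toMatrix {ι : Type*} [Fintype ι] [DecidableEq ι] (C : Circuit ι) :
    Matrix (ι → Fin 2) (ι → Fin 2) ℂ :=
  C.layers.flatten.foldl (fun M g => g.toMatrix * M) 1

/-- The state `|ψ⟩ ⊗ |0…0⟩` : the register `ι` in state `ψ`, together with `a` qubits at `|0⟩`. -/
def withClean {ι : Type*} (a : ℕ) (ψ : (ι → Fin 2) → ℂ) : (ι ⊕ Fin a → Fin 2) → ℂ :=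
  fun z => if ∀ k : Fin a, z (Sum.inr k) = 0 then ψ (fun i => z (Sum.inl i)) else 0

/-- The circuit `C` implements the operator `V` exactly with `a` clean ancillary qubits: these start
at `|0⟩` and are returned to `|0⟩`, that is, `C (|ψ⟩ ⊗ |0…0⟩) = (V |ψ⟩) ⊗ |0…0⟩` for every `ψ`. -/
def Circuit.Implements {ι : Type*} [Fintype ι] [DecidableEq ι] {a : ℕ}
    (C : Circuit (ι ⊕ Fin a)) (V : Matrix (ι → Fin 2) (ι → Fin 2) ℂ) : Prop :=
  ∀ ψ : (ι → Fin 2) → ℂ,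
    C.toMatrix.mulVec (withClean a ψ) = withClean a (V.mulVec ψ)

end QCircuit

open Function

namespace QCircuit

/-! It suffices to find a permutation circuit `f` of logarithmic depth and linear size, on the
controls and the ancilla `a`, after which all controls were at 1 exactly when two designated qubits
are at 1. Then `f`, a doubly controlled `U`, and `f⁻¹` give the gate. Because of the final `f⁻¹`,
`f` may leave any garbage. `Realizes.controlled_controlled` builds the middle gate exactly.

One clean qubit is enough for `f` because controls become conditionally clean. If a clean flag
receives the conjunction of a block `X` and `X` is then flipped, `X` is at 0 whenever the flag is at
1; when the flag is at 0 the full conjunction is false anyway, so the block may serve as workspace.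
In each stage, `2b` conditionally clean qubits absorb `3b` further controls into `b` flags in
constant depth (`exists_absorb`), and the other `b` clean qubits serve to merge these flags into one
(`exists_merge`). The clean supply gains `b`, hence grows by a factor of at least 4/3 until at most
two controls are left, so there are O(log n) stages.

A merge has logarithmic depth, and performing the merges stage by stage would cost log² n. But later
absorptions never touch the qubits of earlier merges, so the merges can be postponed past all
absorptions and run in parallel. `AbsorbedInto` records this separation: `p` collects the
absorptions and `q` the merges.

Finally there are O(log n) flags and at most two leftover controls. The conjunction of all of these
except `a` is written into a reserved qubit `r`, clean when `a` is at 1, by a NOT gate whose cost is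
linear in its number of controls and which only borrows qubits in arbitrary states
(`Computes.toggle`). This gives `exists_conjunction`. -/

theorem forall_update_eq_one_iff {ι : Type*} [DecidableEq ι] {c : Finset ι} {t : ι} (ht : t ∉ c)
    (y : ι → Fin 2) (b : Fin 2) : (∀ i ∈ c, update y t b i = 1) ↔ ∀ i ∈ c, y i = 1 :=
  forall₂_congr fun i hi => by rw [update_of_ne (ne_of_mem_of_not_mem hi ht)]

/-- The inverse of a gate. -/
noncomputable def Gate.inv {ι : Type*} : Gate ι → Gate ι
  | .single t U => .single t U⁻¹
  | .cnot c t h => .cnot c t h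

theorem Gate.qubits_inv {ι : Type*} [DecidableEq ι] (g : Gate ι) : g.inv.qubits = g.qubits := by
  cases g <;> rfl

/-! ### Action of gates on states; sequential, parallel and inverse circuits. -/

section Operators

variable {ι : Type*} [Fintype ι] [DecidableEq ι]

/-- Only the two basis states that agree with `y` off `t` contribute. All later operator identities
are checked pointwise through this formula. -/
theorem controlled_mulVec {c : Finset ι} {t : ι} (ht : t ∉ c) (U : Matrix (Fin 2) (Fin 2) ℂ)
    (ψ : (ι → Fin 2) → ℂ) (y : ι → Fin 2) :
    (controlled c t U).mulVec ψ y =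
      if ∀ i ∈ c, y i = 1 then ∑ b, U (y t) b * ψ (update y t b) else ψ y := by
  have key : (controlled c t U).mulVec ψ y =
      ∑ b, controlled c t U y (update y t b) * ψ (update y t b) := by
    rw [Matrix.mulVec, dotProduct,
      ← Finset.sum_image (s := Finset.univ) (g := fun b => update y t b)
        (f := fun x => controlled c t U y x * ψ x) (fun a _ b _ h => update_injective y t h)]
    refine (Finset.sum_subset (Finset.subset_univ _) fun x _ hx => ?_).symm
    have : ¬ ∀ j, j ≠ t → y j = x j := fun h => hx <| Finset.mem_image.2
      ⟨x t, Finset.mem_univ _, funext fun j => by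
        by_cases hj : j = t
        · subst hj; simp
        · simp [hj, h j hj]⟩
    simp [controlled, this]
  have hc : ∀ b, (∀ i ∈ c, update y t b i = 1) ↔ ∀ i ∈ c, y i = 1 := forall_update_eq_one_iff ht y
  have hj : ∀ b j, j ≠ t → y j = update y t b j := fun b j h => by rw [update_of_ne h]
  rw [key]
  by_cases h : ∀ i ∈ c, y i = 1
  · simp only [controlled, Matrix.of_apply, if_pos (hj _), if_pos ((hc _).2 h), if_pos h,
      update_self]
  · simp only [controlled, Matrix.of_apply, if_pos (hj _), if_neg (fun h' => h ((hc _).1 h')),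
      if_neg h, update_self, Matrix.one_apply, ite_mul, one_mul, zero_mul, Finset.sum_ite_eq,
      Finset.mem_univ, if_true, update_eq_self]

theorem matrix_ext_mulVec {α : Type*} [Fintype α] {M N : Matrix α α ℂ}
    (h : ∀ ψ y, M.mulVec ψ y = N.mulVec ψ y) : M = N :=
  Matrix.mulVec_injective (funext fun ψ => funext (h ψ))

theorem controlled_mul {c : Finset ι} {t : ι} (ht : t ∉ c) (U V : Matrix (Fin 2) (Fin 2) ℂ) :
    controlled c t U * controlled c t V = controlled c t (U * V) := by
  refine matrix_ext_mulVec fun ψ y => ?_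
  have hc : ∀ b, (∀ i ∈ c, update y t b i = 1) ↔ ∀ i ∈ c, y i = 1 := forall_update_eq_one_iff ht y
  rw [← Matrix.mulVec_mulVec, controlled_mulVec ht, controlled_mulVec ht]
  by_cases h : ∀ i ∈ c, y i = 1
  · simp only [if_pos h, controlled_mulVec ht, hc, update_self, update_idem, Matrix.mul_apply,
      Fin.sum_univ_two]
    ring
  · simp only [if_neg h, controlled_mulVec ht]

theorem controlled_one {c : Finset ι} {t : ι} (ht : t ∉ c) :
    controlled c t (1 : Matrix (Fin 2) (Fin 2) ℂ) = 1 := by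
  refine matrix_ext_mulVec fun ψ y => ?_
  simp [controlled_mulVec ht, Matrix.one_apply]

theorem controlled_commute {c c' : Finset ι} {t t' : ι} (ht : t ∉ c) (ht' : t' ∉ c')
    (htt : t ≠ t') (htc : t ∉ c') (htc' : t' ∉ c) (U V : Matrix (Fin 2) (Fin 2) ℂ) :
    controlled c t U * controlled c' t' V = controlled c' t' V * controlled c t U := by
  refine matrix_ext_mulVec fun ψ y => ?_
  have h1 : ∀ b, (∀ i ∈ c', update y t b i = 1) ↔ ∀ i ∈ c', y i = 1 := forall_update_eq_one_iff htc y
  have h2 : ∀ b, (∀ i ∈ c, update y t' b i = 1) ↔ ∀ i ∈ c, y i = 1 := forall_update_eq_one_iff htc' y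
  rw [← Matrix.mulVec_mulVec, ← Matrix.mulVec_mulVec]
  simp only [controlled_mulVec ht, controlled_mulVec ht', h1, h2, update_of_ne htt,
    update_of_ne htt.symm, Fin.sum_univ_two, update_comm htt.symm]
  split_ifs <;> ring

theorem Gate.inv_mul (g : Gate ι) : g.inv.toMatrix * g.toMatrix = 1 := by
  cases g with
  | single t U =>
    simp only [Gate.inv, Gate.toMatrix]
    rw [controlled_mul (Finset.notMem_empty t), ← Submonoid.coe_mul, inv_mul_cancel]
    exact controlled_one (Finset.notMem_empty t)
  | cnot c t h =>
    have ht : t ∉ ({c} : Finset ι) := by simpa using h.symm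
    simp only [Gate.inv, Gate.toMatrix]
    rw [controlled_mul ht, ← controlled_one ht]
    congr 1
    ext i j
    fin_cases i <;> fin_cases j <;> simp

theorem Gate.commute {g h : Gate ι} (hd : Disjoint g.qubits h.qubits) :
    Commute g.toMatrix h.toMatrix := by
  cases g <;> cases h <;> simp only [Gate.qubits, Gate.toMatrix, Finset.disjoint_left,
    Finset.mem_insert, Finset.mem_singleton, forall_eq_or_imp, forall_eq, not_or] at hd ⊢ <;>
    refine controlled_commute ?_ ?_ ?_ ?_ ?_ _ _  <;> grind

/-- The operator of a list of gates, the first gate being performed first. -/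
noncomputable def gatesMatrix (l : List (Gate ι)) : Matrix (ι → Fin 2) (ι → Fin 2) ℂ :=
  l.foldl (fun M g => g.toMatrix * M) 1

theorem gatesMatrix_nil : gatesMatrix ([] : List (Gate ι)) = 1 := rfl

theorem gatesMatrix_append (l₁ l₂ : List (Gate ι)) :
    gatesMatrix (l₁ ++ l₂) = gatesMatrix l₂ * gatesMatrix l₁ := by
  have key : ∀ (l : List (Gate ι)) (M : Matrix (ι → Fin 2) (ι → Fin 2) ℂ),
      l.foldl (fun M g => g.toMatrix * M) M = gatesMatrix l * M := by
    intro l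
    induction l with
    | nil => intro M; simp [gatesMatrix]
    | cons g l ih =>
      intro M
      rw [gatesMatrix, List.foldl_cons, List.foldl_cons, ih, ih (g.toMatrix * 1), mul_one,
        mul_assoc]
  rw [gatesMatrix, List.foldl_append, key]
  rfl

theorem gatesMatrix_cons (g : Gate ι) (l : List (Gate ι)) :
    gatesMatrix (g :: l) = gatesMatrix l * g.toMatrix := by
  have := gatesMatrix_append [g] l
  simpa [gatesMatrix] using this

theorem gatesMatrix_commute {l₁ l₂ : List (Gate ι)}
    (h : ∀ g ∈ l₁, ∀ g' ∈ l₂, Disjoint g.qubits g'.qubits) :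
    Commute (gatesMatrix l₁) (gatesMatrix l₂) := by
  induction l₁ with
  | nil => exact Commute.one_left _
  | cons g l₁ ih =>
    rw [gatesMatrix_cons]
    refine (ih fun g hg => h g (List.mem_cons_of_mem _ hg)).mul_left ?_
    replace h := h g List.mem_cons_self
    clear ih
    induction l₂ with
    | nil => exact Commute.one_right _
    | cons g' l₂ ih =>
      rw [gatesMatrix_cons]
      exact (ih fun g' hg => h g' (List.mem_cons_of_mem _ hg)).mul_right
        (Gate.commute (h g' List.mem_cons_self))

/-- The operator `M` is performed by a circuit of depth at most `d` and size at most `s` that acts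
on the qubits in `S` only. -/
def Realizes (S : Finset ι) (d s : ℕ) (M : Matrix (ι → Fin 2) (ι → Fin 2) ℂ) : Prop :=
  ∃ C : Circuit ι, (∀ L ∈ C.layers, ∀ g ∈ L, g.qubits ⊆ S) ∧ C.depth ≤ d ∧ C.size ≤ s ∧
    C.toMatrix = M

theorem Circuit.toMatrix_eq (C : Circuit ι) : C.toMatrix = gatesMatrix C.layers.flatten := rfl

theorem Realizes.mono {S S' : Finset ι} {d d' s s' : ℕ} {M : Matrix (ι → Fin 2) (ι → Fin 2) ℂ}
    (h : Realizes S d s M) (hS : S ⊆ S') (hd : d ≤ d') (hs : s ≤ s') : Realizes S' d' s' M := by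
  obtain ⟨C, h1, h2, h3, h4⟩ := h
  exact ⟨C, fun L hL g hg => (h1 L hL g hg).trans hS, h2.trans hd, h3.trans hs, h4⟩

theorem Realizes.one (S : Finset ι) : Realizes S 0 0 1 :=
  ⟨⟨[], by simp⟩, by simp, le_rfl, le_rfl, rfl⟩

theorem Realizes.mul {S : Finset ι} {d d' s s' : ℕ} {M N : Matrix (ι → Fin 2) (ι → Fin 2) ℂ}
    (hM : Realizes S d s M) (hN : Realizes S d' s' N) :
    Realizes S (d + d') (s + s') (N * M) := by
  obtain ⟨C, h1, h2, h3, h4⟩ := hM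
  obtain ⟨C', h1', h2', h3', h4'⟩ := hN
  refine ⟨⟨C.layers ++ C'.layers, fun L hL => ?_⟩, fun L hL => ?_, ?_, ?_, ?_⟩
  · exact (List.mem_append.1 hL).elim (C.disjoint L) (C'.disjoint L)
  · exact (List.mem_append.1 hL).elim (h1 L) (h1' L)
  · simpa [Circuit.depth] using add_le_add h2 h2'
  · simpa [Circuit.size] using add_le_add h3 h3'
  · rw [← h4, ← h4', Circuit.toMatrix_eq, Circuit.toMatrix_eq, Circuit.toMatrix_eq,
      ← gatesMatrix_append, List.flatten_append]

theorem Realizes.gate (g : Gate ι) : Realizes g.qubits 1 1 g.toMatrix :=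
  ⟨⟨[[g]], by simp⟩, by simp, le_rfl, le_rfl, by simp [Circuit.toMatrix]⟩

/-- The two circuits are zipped layer by layer. Gates with disjoint supports commute, so the
interleaving performs the same product. -/
theorem exists_parallel_layers (S S' : Finset ι) (hS : Disjoint S S') :
    ∀ l l' : List (List (Gate ι)),
      (∀ L ∈ l, L.Pairwise fun g h => Disjoint g.qubits h.qubits) →
      (∀ L ∈ l', L.Pairwise fun g h => Disjoint g.qubits h.qubits) →
      (∀ L ∈ l, ∀ g ∈ L, g.qubits ⊆ S) → (∀ L ∈ l', ∀ g ∈ L, g.qubits ⊆ S') →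
      ∃ k : List (List (Gate ι)), (∀ L ∈ k, L.Pairwise fun g h => Disjoint g.qubits h.qubits) ∧
        (∀ L ∈ k, ∀ g ∈ L, g.qubits ⊆ S ∪ S') ∧ k.length = max l.length l'.length ∧
        (k.map List.length).sum = (l.map List.length).sum + (l'.map List.length).sum ∧
        gatesMatrix k.flatten = gatesMatrix l'.flatten * gatesMatrix l.flatten
  | [], l', _, h2, _, h4 => ⟨l', h2, fun L hL g hg => (h4 L hL g hg).trans
      Finset.subset_union_right, by simp, by simp, by simp [gatesMatrix_nil]⟩
  | L :: l, [], h1, _, h3, _ => ⟨L :: l, h1, fun L hL g hg => (h3 L hL g hg).trans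
      Finset.subset_union_left, by simp, by simp, by simp [gatesMatrix_nil]⟩
  | L :: l, L' :: l', h1, h2, h3, h4 => by
    obtain ⟨k, k1, k2, k3, k4, k5⟩ := exists_parallel_layers S S' hS l l'
      (fun L hL => h1 L (List.mem_cons_of_mem _ hL)) (fun L hL => h2 L (List.mem_cons_of_mem _ hL))
      (fun L hL => h3 L (List.mem_cons_of_mem _ hL)) (fun L hL => h4 L (List.mem_cons_of_mem _ hL))
    have hL := h3 L List.mem_cons_self
    have hL' := h4 L' List.mem_cons_self
    refine ⟨(L ++ L') :: k, ?_, ?_, ?_, ?_, ?_⟩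
    · intro M hM
      rcases List.mem_cons.1 hM with rfl | hM
      · exact List.pairwise_append.2 ⟨h1 L List.mem_cons_self, h2 L' List.mem_cons_self,
          fun g hg g' hg' => hS.mono (hL g hg) (hL' g' hg')⟩
      · exact k1 M hM
    · intro M hM
      rcases List.mem_cons.1 hM with rfl | hM
      · intro g hg
        rcases List.mem_append.1 hg with hg | hg
        · exact (hL g hg).trans Finset.subset_union_left
        · exact (hL' g hg).trans Finset.subset_union_right
      · exact k2 M hM
    · simp [k3]
    · simp only [List.map_cons, List.sum_cons, List.length_append, k4]; omega
    · have hc : Commute (gatesMatrix l.flatten) (gatesMatrix L') := gatesMatrix_commute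
        fun g hg g' hg' => by
          obtain ⟨M, hM, hg⟩ := List.mem_flatten.1 hg
          exact hS.mono (h3 M (List.mem_cons_of_mem _ hM) g hg) (hL' g' hg')
      simp only [List.flatten_cons, gatesMatrix_append, k5]
      simp only [mul_assoc]
      rw [← mul_assoc (gatesMatrix l.flatten), hc.eq, mul_assoc]

theorem Realizes.parallel {S S' : Finset ι} (hS : Disjoint S S') {d d' s s' : ℕ}
    {M N : Matrix (ι → Fin 2) (ι → Fin 2) ℂ}
    (hM : Realizes S d s M) (hN : Realizes S' d' s' N) :
    Realizes (S ∪ S') (max d d') (s + s') (N * M) := by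
  obtain ⟨C, h1, h2, h3, h4⟩ := hM
  obtain ⟨C', h1', h2', h3', h4'⟩ := hN
  obtain ⟨k, k1, k2, k3, k4, k5⟩ := exists_parallel_layers S S' hS C.layers C'.layers
    C.disjoint C'.disjoint h1 h1'
  refine ⟨⟨k, k1⟩, k2, ?_, ?_, ?_⟩
  · rw [Circuit.depth, k3]; exact max_le_max h2 h2'
  · rw [Circuit.size, k4]; exact add_le_add h3 h3'
  · rw [← h4, ← h4']; exact k5

theorem Realizes.exists_inv {S : Finset ι} {d s : ℕ} {M : Matrix (ι → Fin 2) (ι → Fin 2) ℂ}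
    (hM : Realizes S d s M) : ∃ N, N * M = 1 ∧ Realizes S d s N := by
  obtain ⟨⟨l, hl⟩, h1, h2, h3, h4⟩ := hM
  simp only [Circuit.depth, Circuit.size, Circuit.toMatrix_eq] at h1 h2 h3 h4
  subst h4
  suffices ∃ k : List (List (Gate ι)), (∀ L ∈ k, L.Pairwise fun g h => Disjoint g.qubits h.qubits) ∧
      (∀ L ∈ k, ∀ g ∈ L, g.qubits ⊆ S) ∧ k.length = l.length ∧
      (k.map List.length).sum = (l.map List.length).sum ∧
      gatesMatrix k.flatten * gatesMatrix l.flatten = 1 by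
    obtain ⟨k, k1, k2, k3, k4, k5⟩ := this
    exact ⟨_, k5, ⟨k, k1⟩, k2, k3.trans_le h2, k4.trans_le h3, rfl⟩
  clear h2 h3
  induction l with
  | nil => exact ⟨[], by simp, by simp, rfl, rfl, by simp [gatesMatrix_nil]⟩
  | cons L l ih =>
    obtain ⟨k, k1, k2, k3, k4, k5⟩ := ih (fun L hL => hl L (List.mem_cons_of_mem _ hL))
      (fun L hL => h1 L (List.mem_cons_of_mem _ hL))
    have hL := hl L List.mem_cons_self
    have hLS := h1 L List.mem_cons_self
    refine ⟨k ++ [(L.map Gate.inv).reverse], ?_, ?_, by simp [k3], ?_, ?_⟩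
    · intro M hM
      rcases List.mem_append.1 hM with hM | hM
      · exact k1 M hM
      · rw [List.mem_singleton.1 hM, List.pairwise_reverse, List.pairwise_map]
        exact hL.imp fun h => by simpa only [Gate.qubits_inv] using h.symm
    · intro M hM
      rcases List.mem_append.1 hM with hM | hM
      · exact k2 M hM
      · rw [List.mem_singleton.1 hM]
        intro g hg
        obtain ⟨g', hg', rfl⟩ := List.mem_map.1 (List.mem_reverse.1 hg)
        rw [Gate.qubits_inv]; exact hLS g' hg'
    · simp [k4]; omega
    · have key : ∀ L : List (Gate ι),
          gatesMatrix (L.map Gate.inv).reverse * gatesMatrix L = 1 := by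
        intro L
        induction L with
        | nil => simp [gatesMatrix_nil]
        | cons g L ih =>
          have h1 : gatesMatrix [g.inv] = g.inv.toMatrix := by simp [gatesMatrix]
          rw [List.map_cons, List.reverse_cons, gatesMatrix_append, gatesMatrix_cons g, h1, mul_assoc,
            ← mul_assoc (gatesMatrix _) (gatesMatrix L), ih, one_mul, Gate.inv_mul]
      rw [List.flatten_append, List.flatten_cons, gatesMatrix_append, gatesMatrix_append,
        List.flatten_cons, List.flatten_nil, gatesMatrix_nil, one_mul,
        gatesMatrix_append L, mul_assoc, ← mul_assoc (gatesMatrix k.flatten), k5, one_mul, key]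

end Operators

/-! ### Diagonalization of 2 × 2 unitaries. -/

section Diagonalization

theorem exists_unit_eigenvector (U : Matrix (Fin 2) (Fin 2) ℂ) :
    ∃ (v : Fin 2 → ℂ) (μ : ℂ), v 0 * star (v 0) + v 1 * star (v 1) = 1 ∧ U.mulVec v = μ • v := by
  obtain ⟨μ, hμ⟩ := Module.End.exists_eigenvalue (Matrix.toLin' U)
  obtain ⟨w, hw⟩ := hμ.exists_hasEigenvector
  have hw1 : U.mulVec w = μ • w := by simpa using hw.apply_eq_smul
  set r : ℝ := Complex.normSq (w 0) + Complex.normSq (w 1) with hr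
  have hpos : 0 < r := by
    have h0 := Complex.normSq_nonneg (w 0)
    have h1 := Complex.normSq_nonneg (w 1)
    by_contra hneg
    have e0 : Complex.normSq (w 0) = 0 := by linarith
    have e1 : Complex.normSq (w 1) = 0 := by linarith
    refine hw.2 (funext fun i => ?_)
    fin_cases i
    · exact Complex.normSq_eq_zero.1 e0
    · exact Complex.normSq_eq_zero.1 e1
  have hs : ((Real.sqrt r : ℝ) : ℂ) ≠ 0 := by
    exact_mod_cast (Real.sqrt_pos.2 hpos).ne'
  have hss : ((Real.sqrt r : ℝ) : ℂ) * (Real.sqrt r : ℝ) = w 0 * star (w 0) + w 1 * star (w 1) := by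
    rw [← Complex.ofReal_mul, Real.mul_self_sqrt hpos.le, hr, Complex.ofReal_add,
      Complex.normSq_eq_conj_mul_self, Complex.normSq_eq_conj_mul_self, starRingEnd_apply,
      starRingEnd_apply]
    ring
  refine ⟨((Real.sqrt r : ℝ) : ℂ)⁻¹ • w, μ, ?_, ?_⟩
  · have : star ((Real.sqrt r : ℝ) : ℂ) = (Real.sqrt r : ℝ) := Complex.conj_ofReal _
    simp only [Pi.smul_apply, smul_eq_mul, star_mul', star_inv₀, this]
    field_simp
    rw [sq, hss]
  · rw [Matrix.mulVec_smul, hw1, smul_comm]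

theorem exists_unitary_diagonalization {U : Matrix (Fin 2) (Fin 2) ℂ}
    (hU : U ∈ Matrix.unitaryGroup (Fin 2) ℂ) :
    ∃ W ∈ Matrix.unitaryGroup (Fin 2) ℂ, ∃ d₀ d₁ : ℂ, ‖d₀‖ = 1 ∧ ‖d₁‖ = 1 ∧
      U = W * Matrix.diagonal ![d₀, d₁] * star W := by
  obtain ⟨v, μ, hv, hev⟩ := exists_unit_eigenvector U
  -- The second column is the unit vector orthogonal to the eigenvector `v`.
  set W : Matrix (Fin 2) (Fin 2) ℂ := !![v 0, -star (v 1); v 1, star (v 0)] with hW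
  have hWu : W ∈ Matrix.unitaryGroup (Fin 2) ℂ := by
    rw [Matrix.mem_unitaryGroup_iff']
    ext i j
    fin_cases i <;> fin_cases j <;>
      simp [hW, Matrix.mul_apply, Fin.sum_univ_two, Matrix.star_apply] <;>
      simp at hv <;> first | ring1 | linear_combination hv
  set T := star W * U * W with hT
  have hTu : T ∈ Matrix.unitaryGroup (Fin 2) ℂ :=
    mul_mem (mul_mem (Unitary.star_mem hWu) hU) hWu
  have h0 : U 0 0 * v 0 + U 0 1 * v 1 = μ * v 0 := by
    simpa [Matrix.mulVec, dotProduct, Fin.sum_univ_two] using congrFun hev 0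
  have h1 : U 1 0 * v 0 + U 1 1 * v 1 = μ * v 1 := by
    simpa [Matrix.mulVec, dotProduct, Fin.sum_univ_two] using congrFun hev 1
  have h10 : T 1 0 = 0 := by
    simp [hT, hW, Matrix.mul_apply, Fin.sum_univ_two, Matrix.star_apply]
    linear_combination v 0 * h1 - v 1 * h0
  have e1 := congrFun (congrFun (Matrix.mem_unitaryGroup_iff'.1 hTu) 0) 0
  have e2 := congrFun (congrFun (Matrix.mem_unitaryGroup_iff.1 hTu) 0) 0
  have e3 := congrFun (congrFun (Matrix.mem_unitaryGroup_iff.1 hTu) 1) 1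
  simp only [Matrix.mul_apply, Fin.sum_univ_two, Matrix.star_apply, h10, Matrix.one_apply_eq,
    star_zero, mul_zero, add_zero, zero_add] at e1 e2 e3
  -- `T` is triangular and unitary: its first row and first column both have norm 1, which leaves
  -- nothing for the off-diagonal entry.
  have h01 : T 0 1 = 0 := by
    have : T 0 1 * star (T 0 1) = 0 := by linear_combination e2 - e1
    simpa using this
  have norm_of : ∀ z : ℂ, z * star z = 1 → ‖z‖ = 1 := fun z hz => by
    have h := congrArg norm hz
    rw [norm_mul, norm_star, norm_one] at h
    nlinarith [norm_nonneg z]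
  refine ⟨W, hWu, T 0 0, T 1 1, norm_of _ (by rw [mul_comm]; exact e1), norm_of _ e3, ?_⟩
  have hd : Matrix.diagonal ![T 0 0, T 1 1] = T := by
    ext i j
    fin_cases i <;> fin_cases j <;> simp [h10, h01]
  have hWW := Matrix.mem_unitaryGroup_iff.1 hWu
  rw [hd, hT]
  calc U = (W * star W) * U * (W * star W) := by rw [hWW, one_mul, mul_one]
    _ = _ := by simp only [mul_assoc]

theorem exists_pow_eq_of_norm_eq_one {z : ℂ} (hz : ‖z‖ = 1) {k : ℕ} (hk : k ≠ 0) :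
    ∃ w : ℂ, ‖w‖ = 1 ∧ w ^ k = z := by
  obtain ⟨w, hw⟩ := IsAlgClosed.exists_pow_nat_eq z (Nat.pos_of_ne_zero hk)
  refine ⟨w, ?_, hw⟩
  have : ‖w‖ ^ k = 1 := by rw [← norm_pow, hw, hz]
  exact (pow_eq_one_iff_of_nonneg (norm_nonneg w) hk).1 this

end Diagonalization

/-! ### Exact synthesis of doubly controlled gates. -/

section ControlledControlled

variable {ι : Type*} [Fintype ι] [DecidableEq ι]

/-- The phase gate `diag(1, z)` on the qubit `t`. -/
noncomputable def phase (t : ι) (z : ℂ) : Matrix (ι → Fin 2) (ι → Fin 2) ℂ :=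
  controlled ∅ t (Matrix.diagonal ![1, z])

theorem phase_mulVec (t : ι) (z : ℂ) (ψ : (ι → Fin 2) → ℂ) (y : ι → Fin 2) :
    (phase t z).mulVec ψ y = (if y t = 1 then z else 1) * ψ y := by
  rw [phase, controlled_mulVec (Finset.notMem_empty t)]
  have h : update y t (y t) = y := update_eq_self t y
  generalize y t = b at h ⊢
  fin_cases b <;> simp [Fin.sum_univ_two] at h ⊢ <;> simp [h]

theorem cnot_mulVec {c t : ι} (h : c ≠ t) (ψ : (ι → Fin 2) → ℂ) (y : ι → Fin 2) :
    (Gate.cnot c t h).toMatrix.mulVec ψ y =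
      ψ (update y t (if y c = 1 then y t + 1 else y t)) := by
  rw [Gate.toMatrix, controlled_mulVec (by simpa using h.symm)]
  by_cases hc : y c = 1
  · simp only [Finset.mem_singleton, forall_eq, hc, if_true]
    generalize y t = b
    fin_cases b <;> simp [Fin.sum_univ_two]
  · simp [hc]

theorem Realizes.single {U : Matrix (Fin 2) (Fin 2) ℂ} (hU : U ∈ Matrix.unitaryGroup (Fin 2) ℂ)
    (t : ι) : Realizes {t} 1 1 (controlled ∅ t U) :=
  Realizes.gate (Gate.single t ⟨U, hU⟩)

theorem Realizes.phase {z : ℂ} (hz : ‖z‖ = 1) (t : ι) : Realizes {t} 1 1 (phase t z) := by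
  refine Realizes.single ?_ t
  have : z * (starRingEnd ℂ) z = 1 := by
    rw [Complex.mul_conj, Complex.normSq_eq_norm_sq, hz]; simp
  rw [Matrix.mem_unitaryGroup_iff]
  ext i j
  fin_cases i <;> fin_cases j <;>
    simp [Matrix.mul_apply, Fin.sum_univ_two, Matrix.star_apply, this]

/-- For bits, `a + b - (a ⊕ b) = 2ab` and `a + b + t - (a ⊕ b) - (b ⊕ t) - (a ⊕ t) + (a ⊕ b ⊕ t) =
4abt`; these are the exponents of `v` and `u`. The CNOTs write each parity onto a qubit, where a
phase gate contributes the corresponding term. -/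
theorem controlled_controlled_diagonal {a b t : ι} (hab : a ≠ b) (hat : a ≠ t) (hbt : b ≠ t)
    {u v : ℂ} (hu : u ≠ 0) (hv : v ≠ 0) :
    controlled {a, b} t (Matrix.diagonal ![v ^ 2, v ^ 2 * u ^ 4]) =
      phase a (v * u) * (phase b (v * u) * (phase t u *
      ((Gate.cnot a b hab).toMatrix * (phase b (v * u)⁻¹ * ((Gate.cnot a b hab).toMatrix *
      ((Gate.cnot a t hat).toMatrix * (phase t u⁻¹ * ((Gate.cnot b t hbt).toMatrix *
      (phase t u * ((Gate.cnot a t hat).toMatrix * (phase t u⁻¹ *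
      (Gate.cnot b t hbt).toMatrix))))))))))) := by
  refine matrix_ext_mulVec fun ψ y => ?_
  have ht : t ∉ ({a, b} : Finset ι) := by simp [hat.symm, hbt.symm]
  rw [controlled_mulVec ht]
  simp only [← Matrix.mulVec_mulVec, phase_mulVec, cnot_mulVec, update_self, update_idem,
    update_of_ne hab, update_of_ne hat, update_of_ne hbt,
    update_of_ne hbt.symm]
  have hup : ∀ {s : ι} {b : Fin 2}, y s = b → update y s b = y := by
    rintro s b rfl
    exact update_eq_self s y
  have h01 : ∀ b : Fin 2, b = 0 ∨ b = 1 := by decide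
  simp only [Finset.mem_insert, Finset.mem_singleton, forall_eq_or_imp, forall_eq]
  rcases h01 (y a) with ha | ha <;> rcases h01 (y b) with hb | hb <;>
    rcases h01 (y t) with hc | hc <;>
    simp [ha, hb, hc, hup hb, hup hc, Fin.sum_univ_two] <;> field_simp

theorem Realizes.controlled_controlled {a b t : ι} (hab : a ≠ b) (hat : a ≠ t) (hbt : b ≠ t)
    {U : Matrix (Fin 2) (Fin 2) ℂ} (hU : U ∈ Matrix.unitaryGroup (Fin 2) ℂ) :
    Realizes {a, b, t} 15 15 (controlled {a, b} t U) := by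
  obtain ⟨W, hW, d₀, d₁, h₀, h₁, rfl⟩ := exists_unitary_diagonalization hU
  obtain ⟨v, hv, hv2⟩ := exists_pow_eq_of_norm_eq_one h₀ two_ne_zero
  obtain ⟨u, hu, hu4⟩ := exists_pow_eq_of_norm_eq_one (z := d₁ / d₀) (k := 4)
    (by rw [norm_div, h₀, h₁, div_one]) (by norm_num)
  have hd₀ : d₀ ≠ 0 := norm_ne_zero_iff.1 (by rw [h₀]; exact one_ne_zero)
  have hu0 : u ≠ 0 := norm_ne_zero_iff.1 (by rw [hu]; exact one_ne_zero)
  have hv0 : v ≠ 0 := norm_ne_zero_iff.1 (by rw [hv]; exact one_ne_zero)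
  have hd₁ : d₁ = v ^ 2 * u ^ 4 := by rw [hv2, hu4]; field_simp
  rw [← hv2] at *
  subst hd₁
  have ht : t ∉ ({a, b} : Finset ι) := by simp [hat.symm, hbt.symm]
  have hWW := Matrix.mem_unitaryGroup_iff.1 hW
  -- The change of basis needs no controls: when the inner gate is inactive, `W` and `star W`
  -- cancel.
  have hconj : controlled {a, b} t (W * Matrix.diagonal ![v ^ 2, v ^ 2 * u ^ 4] * star W) =
      controlled ∅ t W * (controlled {a, b} t (Matrix.diagonal ![v ^ 2, v ^ 2 * u ^ 4]) *
        controlled ∅ t (star W)) := by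
    refine matrix_ext_mulVec fun ψ y => ?_
    have hte := Finset.notMem_empty t
    simp only [← Matrix.mulVec_mulVec, controlled_mulVec ht, controlled_mulVec hte,
      forall_update_eq_one_iff ht]
    by_cases h : ∀ i ∈ ({a, b} : Finset ι), y i = 1
    · simp only [if_pos h, update_self, update_idem, Matrix.mul_apply, Fin.sum_univ_two,
        Finset.notMem_empty, false_imp_iff, implies_true, if_true]
      simp
      ring
    · have h2 := controlled_mul hte W (star W)
      rw [hWW, controlled_one hte] at h2
      have h3 := congrFun (congrArg (fun M => Matrix.mulVec M ψ) h2) y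
      simp only [← Matrix.mulVec_mulVec, controlled_mulVec hte, Matrix.one_mulVec] at h3
      simp only [if_neg h]
      simpa using h3.symm
  rw [hconj, controlled_controlled_diagonal hab hat hbt hu0 hv0]
  have huv : ‖v * u‖ = 1 := by rw [norm_mul, hu, hv, mul_one]
  have huv' : ‖(v * u)⁻¹‖ = 1 := by rw [norm_inv, huv, inv_one]
  have hu' : ‖u⁻¹‖ = 1 := by rw [norm_inv, hu, inv_one]
  have ha : ({a} : Finset ι) ⊆ {a, b, t} := by simp
  have hb : ({b} : Finset ι) ⊆ {a, b, t} := by simp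
  have ht : ({t} : Finset ι) ⊆ {a, b, t} := by simp
  have Ra : ∀ {z : ℂ}, ‖z‖ = 1 → Realizes {a, b, t} 1 1 (QCircuit.phase a z) := fun hz =>
    (Realizes.phase hz a).mono ha le_rfl le_rfl
  have Rb : ∀ {z : ℂ}, ‖z‖ = 1 → Realizes {a, b, t} 1 1 (QCircuit.phase b z) := fun hz =>
    (Realizes.phase hz b).mono hb le_rfl le_rfl
  have Rt : ∀ {z : ℂ}, ‖z‖ = 1 → Realizes {a, b, t} 1 1 (QCircuit.phase t z) := fun hz =>
    (Realizes.phase hz t).mono ht le_rfl le_rfl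
  have Rab : Realizes {a, b, t} 1 1 (Gate.cnot a b hab).toMatrix :=
    (Realizes.gate _).mono (by simp [Gate.qubits, Finset.insert_subset_iff]) le_rfl le_rfl
  have Rat : Realizes {a, b, t} 1 1 (Gate.cnot a t hat).toMatrix :=
    (Realizes.gate _).mono (by simp [Gate.qubits, Finset.insert_subset_iff]) le_rfl le_rfl
  have Rbt : Realizes {a, b, t} 1 1 (Gate.cnot b t hbt).toMatrix :=
    (Realizes.gate _).mono (by simp [Gate.qubits]) le_rfl le_rfl
  exact (((Realizes.single (Unitary.star_mem hW) t).mono ht le_rfl le_rfl).mul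
    ((((((((((((Rbt.mul (Rt hu')).mul Rat).mul (Rt hu)).mul Rbt).mul (Rt hu')).mul Rat).mul
      Rab).mul (Rb huv')).mul Rab).mul (Rt hu)).mul (Rb huv)).mul (Ra huv))).mul
    ((Realizes.single hW t).mono ht le_rfl le_rfl)

end ControlledControlled

/-! ### Permutations of the computational basis and the qubits they depend on. -/

section Permutations

variable {ι : Type*}

/-- The permutation `f` of the computational basis changes the qubits in `S` only, and what it does
to them depends on these qubits only. -/
structure IsLocal (S : Finset ι) (f : Equiv.Perm (ι → Fin 2)) : Prop where
  apply_of_notMem : ∀ x j, j ∉ S → f x j = x j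
  congr : ∀ x y, (∀ i ∈ S, x i = y i) → ∀ i ∈ S, f x i = f y i

theorem IsLocal.mono {S S' : Finset ι} {f : Equiv.Perm (ι → Fin 2)} (h : IsLocal S f)
    (hS : S ⊆ S') : IsLocal S' f := by
  refine ⟨fun x j hj => h.apply_of_notMem x j fun h => hj (hS h), fun x y hxy i hi => ?_⟩
  by_cases hiS : i ∈ S
  · exact h.congr x y (fun j hj => hxy j (hS hj)) i hiS
  · rw [h.apply_of_notMem x i hiS, h.apply_of_notMem y i hiS, hxy i hi]

theorem IsLocal.one (S : Finset ι) : IsLocal S 1 := ⟨fun _ _ _ => rfl, fun _ _ h => h⟩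

theorem IsLocal.mul {S : Finset ι} {f g : Equiv.Perm (ι → Fin 2)} (hf : IsLocal S f)
    (hg : IsLocal S g) : IsLocal S (g * f) :=
  ⟨fun x j hj => (hg.apply_of_notMem (f x) j hj).trans (hf.apply_of_notMem x j hj),
    fun x y h => hg.congr _ _ (hf.congr x y h)⟩

theorem IsLocal.inv [Fintype ι] {S : Finset ι} {f : Equiv.Perm (ι → Fin 2)} (hf : IsLocal S f) :
    IsLocal S f⁻¹ := by
  -- The group of permutations is finite, so the inverse is a power of `f` and inherits locality
  -- from products.
  have hpow : ∀ k : ℕ, IsLocal S (f ^ k) := fun k => by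
    induction k with
    | zero => exact IsLocal.one S
    | succ k ih => rw [pow_succ]; exact hf.mul ih
  have : f⁻¹ = f ^ (orderOf f - 1) := by
    rw [inv_eq_iff_mul_eq_one, ← pow_succ', Nat.sub_add_cancel (orderOf_pos f), pow_orderOf_eq_one]
  exact this ▸ hpow _

theorem IsLocal.commute {S S' : Finset ι} {f g : Equiv.Perm (ι → Fin 2)} (hf : IsLocal S f)
    (hg : IsLocal S' g) (h : Disjoint S S') : Commute f g := by
  classical
  ext x j : 2
  simp only [Equiv.Perm.mul_apply]
  by_cases hj : j ∈ S
  · have hj' := Finset.disjoint_left.1 h hj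
    rw [hg.apply_of_notMem _ j hj']
    exact hf.congr _ _ (fun i hi => hg.apply_of_notMem _ i (Finset.disjoint_left.1 h hi)) j hj
  · rw [hf.apply_of_notMem _ j hj]
    by_cases hj' : j ∈ S'
    · exact (hg.congr _ _ (fun i hi => hf.apply_of_notMem _ i (Finset.disjoint_right.1 h hi))
        j hj').symm
    · rw [hg.apply_of_notMem _ j hj', hg.apply_of_notMem _ j hj', hf.apply_of_notMem _ j hj]

/-- A qubit outside the support is a spectator. In the end this carries `f⁻¹` past the change of the
target qubit. -/
theorem IsLocal.apply_update [DecidableEq ι] {S : Finset ι} {f : Equiv.Perm (ι → Fin 2)}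
    (hf : IsLocal S f) {t : ι} (ht : t ∉ S) (x : ι → Fin 2) (b : Fin 2) :
    f (update x t b) = update (f x) t b := by
  funext j
  by_cases hjt : j = t
  · subst hjt
    rw [hf.apply_of_notMem _ j ht, update_self, update_self]
  rw [update_of_ne hjt]
  by_cases hj : j ∈ S
  · exact hf.congr _ _ (fun i hi => update_of_ne (ne_of_mem_of_not_mem hi ht) _ _) j hj
  · rw [hf.apply_of_notMem _ j hj, hf.apply_of_notMem _ j hj, update_of_ne hjt]

variable [DecidableEq ι]

/-- The map that flips the qubit `t` if all qubits in `c` other than `t` are at `|1⟩`. -/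
def toggleFun (c : Finset ι) (t : ι) (x : ι → Fin 2) : ι → Fin 2 :=
  update x t (x t + if ∀ i ∈ c.erase t, x i = 1 then 1 else 0)

theorem toggleFun_involutive (c : Finset ι) (t : ι) : Involutive (toggleFun c t) := by
  intro x
  have h2 : ∀ b e : Fin 2, b + e + e = b := by decide
  rw [toggleFun, toggleFun]
  simp only [forall_update_eq_one_iff (Finset.notMem_erase t c), update_self, update_idem, h2,
    update_eq_self]

/-- The permutation of the computational basis performed by a NOT gate on `t` with controls `c`. -/
def toggle (c : Finset ι) (t : ι) : Equiv.Perm (ι → Fin 2) := (toggleFun_involutive c t).toPerm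

theorem toggle_apply_self {c : Finset ι} {t : ι} (ht : t ∉ c) (x : ι → Fin 2) :
    toggle c t x t = x t + if ∀ i ∈ c, x i = 1 then 1 else 0 := by
  simp only [toggle, Involutive.coe_toPerm, toggleFun, update_self, Finset.erase_eq_of_notMem ht]

theorem toggle_apply_of_ne (c : Finset ι) {t j : ι} (hj : j ≠ t) (x : ι → Fin 2) :
    toggle c t x j = x j := update_of_ne hj _ _

theorem toggle_inv (c : Finset ι) (t : ι) : (toggle c t)⁻¹ = toggle c t := rfl

theorem isLocal_toggle {c : Finset ι} {t : ι} (ht : t ∉ c) : IsLocal (insert t c) (toggle c t) := by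
  refine ⟨fun x j hj => toggle_apply_of_ne c (fun h => hj (by simp [h])) x,
    fun x y h i hi => ?_⟩
  by_cases hit : i = t
  · subst hit
    rw [toggle_apply_self ht, toggle_apply_self ht, h i hi]
    have : (∀ j ∈ c, x j = 1) ↔ ∀ j ∈ c, y j = 1 :=
      forall₂_congr fun j hj => by rw [h j (Finset.mem_insert_of_mem hj)]
    simp only [this]
  · rw [toggle_apply_of_ne c hit, toggle_apply_of_ne c hit, h i hi]

end Permutations

/-! ### Circuits for basis permutations, and NOT gates with many controls and borrowed qubits. -/

section Computes

variable {ι : Type*} [Fintype ι] [DecidableEq ι]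

/-- The operator that maps `|x⟩` to `|f x⟩`. -/
noncomputable def basisMatrix (f : Equiv.Perm (ι → Fin 2)) :
    Matrix (ι → Fin 2) (ι → Fin 2) ℂ := (f⁻¹).permMatrix ℂ

theorem basisMatrix_mulVec (f : Equiv.Perm (ι → Fin 2)) (ψ : (ι → Fin 2) → ℂ) (y : ι → Fin 2) :
    (basisMatrix f).mulVec ψ y = ψ (f⁻¹ y) := by
  rw [basisMatrix, Matrix.permMatrix_mulVec]; rfl

theorem basisMatrix_mul (f g : Equiv.Perm (ι → Fin 2)) :
    basisMatrix (g * f) = basisMatrix g * basisMatrix f := by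
  rw [basisMatrix, mul_inv_rev, Matrix.permMatrix_mul]; rfl

theorem controlled_not {c : Finset ι} {t : ι} (ht : t ∉ c) :
    controlled c t !![0, 1; 1, 0] = basisMatrix (toggle c t) := by
  refine matrix_ext_mulVec fun ψ y => ?_
  rw [controlled_mulVec ht, basisMatrix_mulVec, toggle_inv]
  change _ = ψ (update y t (y t + _))
  rw [Finset.erase_eq_of_notMem ht]
  by_cases h : ∀ i ∈ c, y i = 1
  · rw [if_pos h, if_pos h]
    generalize y t = b
    fin_cases b <;> simp [Fin.sum_univ_two]
  · rw [if_neg h, if_neg h, add_zero, update_eq_self]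

/-- The permutation `f` of the computational basis is local to `S`, and it is performed by a circuit
on `S` of depth at most `d` and size at most `s`. -/
structure Computes (S : Finset ι) (d s : ℕ) (f : Equiv.Perm (ι → Fin 2)) : Prop where
  realizes : Realizes S d s (basisMatrix f)
  isLocal : IsLocal S f

theorem Computes.mono {S S' : Finset ι} {d d' s s' : ℕ} {f : Equiv.Perm (ι → Fin 2)}
    (h : Computes S d s f) (hS : S ⊆ S') (hd : d ≤ d') (hs : s ≤ s') : Computes S' d' s' f :=
  ⟨h.realizes.mono hS hd hs, h.isLocal.mono hS⟩

theorem Computes.apply_of_notMem {S : Finset ι} {d s : ℕ} {f : Equiv.Perm (ι → Fin 2)}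
    (h : Computes S d s f) {j : ι} (hj : j ∉ S) (x : ι → Fin 2) : f x j = x j :=
  h.isLocal.apply_of_notMem x j hj

theorem Computes.one (S : Finset ι) : Computes S 0 0 1 :=
  ⟨by rw [basisMatrix, inv_one, Matrix.permMatrix_one]; exact Realizes.one S, IsLocal.one S⟩

theorem Computes.mul {S : Finset ι} {d d' s s' : ℕ} {f g : Equiv.Perm (ι → Fin 2)}
    (hf : Computes S d s f) (hg : Computes S d' s' g) : Computes S (d + d') (s + s') (g * f) :=
  ⟨by rw [basisMatrix_mul]; exact hf.realizes.mul hg.realizes, hf.isLocal.mul hg.isLocal⟩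

theorem Computes.parallel {S S' : Finset ι} (hS : Disjoint S S') {d d' s s' : ℕ}
    {f g : Equiv.Perm (ι → Fin 2)} (hf : Computes S d s f) (hg : Computes S' d' s' g) :
    Computes (S ∪ S') (max d d') (s + s') (g * f) :=
  ⟨by rw [basisMatrix_mul]; exact hf.realizes.parallel hS hg.realizes,
    (hf.isLocal.mono Finset.subset_union_left).mul (hg.isLocal.mono Finset.subset_union_right)⟩

theorem Computes.inv {S : Finset ι} {d s : ℕ} {f : Equiv.Perm (ι → Fin 2)}
    (hf : Computes S d s f) : Computes S d s f⁻¹ := by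
  refine ⟨?_, hf.isLocal.inv⟩
  obtain ⟨N, hN, hR⟩ := hf.realizes.exists_inv
  have : N = basisMatrix f⁻¹ := by
    have h1 : basisMatrix f * basisMatrix f⁻¹ = 1 := by
      rw [← basisMatrix_mul, mul_inv_cancel, basisMatrix, inv_one, Matrix.permMatrix_one]
    calc N = N * (basisMatrix f * basisMatrix f⁻¹) := by rw [h1, mul_one]
      _ = basisMatrix f⁻¹ := by rw [← mul_assoc, hN, one_mul]
  exact this ▸ hR

theorem not_mem_unitaryGroup : (!![0, 1; 1, 0] : Matrix (Fin 2) (Fin 2) ℂ) ∈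
    Matrix.unitaryGroup (Fin 2) ℂ := by
  rw [Matrix.mem_unitaryGroup_iff]
  ext i j
  fin_cases i <;> fin_cases j <;> simp [Matrix.mul_apply, Fin.sum_univ_two, Matrix.star_apply]

theorem Computes.toggle_of_card_le_two {c : Finset ι} {t : ι} (ht : t ∉ c) (hc : c.card ≤ 2) :
    Computes (insert t c) 15 15 (toggle c t) := by
  refine ⟨?_, isLocal_toggle ht⟩
  rw [← controlled_not ht]
  obtain h | h | h : c.card = 0 ∨ c.card = 1 ∨ c.card = 2 := by omega
  · obtain rfl := Finset.card_eq_zero.1 h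
    exact (Realizes.single not_mem_unitaryGroup t).mono (by simp) (by norm_num) (by norm_num)
  · obtain ⟨a, rfl⟩ := Finset.card_eq_one.1 h
    have hat : a ≠ t := fun h => ht (by simp [h])
    exact (Realizes.gate (Gate.cnot a t hat)).mono
      (by simp [Gate.qubits, Finset.insert_subset_iff]) (by norm_num) (by norm_num)
  · obtain ⟨a, b, hab, rfl⟩ := Finset.card_eq_two.1 h
    have hat : a ≠ t := fun h => ht (by simp [h])
    have hbt : b ≠ t := fun h => ht (by simp [h])
    exact (Realizes.controlled_controlled hab hat hbt not_mem_unitaryGroup).mono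
      (by simp [Finset.insert_subset_iff]) le_rfl le_rfl

/-- The ladder of NOT gates with two controls each. -/
theorem exists_ladder (m : ℕ) : ∀ (c D : Finset ι) (t : ι), Disjoint c D → t ∉ c → t ∉ D →
    c.card = m + 2 → D.card = m → ∃ h : Equiv.Perm (ι → Fin 2),
      (∀ x, ∀ i ∈ c, h x i = x i) ∧
      Computes (c ∪ D) (15 * (2 * m + 1)) (15 * (2 * m + 1)) h ∧
      Computes (insert t (c ∪ D)) (15 * (2 * m + 1)) (15 * (2 * m + 1)) (toggle c t * h) := by
  induction m with
  | zero =>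
    intro c D t _ htc _ hc hD
    obtain rfl := Finset.card_eq_zero.1 hD
    refine ⟨1, fun _ _ _ => rfl, (Computes.one _).mono le_rfl (Nat.zero_le _) (Nat.zero_le _), ?_⟩
    rw [mul_one]
    exact (Computes.toggle_of_card_le_two htc hc.le).mono (by simp) le_rfl le_rfl
  | succ m ih =>
    intro c D t hcD htc htD hc hD
    obtain ⟨a, c, hac, rfl, hc'⟩ := Finset.card_eq_succ.1 hc
    obtain ⟨e, D, heD, rfl, hD'⟩ := Finset.card_eq_succ.1 hD
    simp only [Finset.disjoint_insert_left, Finset.disjoint_insert_right, Finset.mem_insert,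
      not_or] at hcD htc htD
    obtain ⟨⟨hea, hec⟩, haD, hcD⟩ := hcD
    have hae : a ≠ e := Ne.symm hea
    obtain ⟨h, hfix, hS, hT⟩ := ih c D e hcD hec heD hc' hD'
    have htoggle : Computes {t, a, e} 15 15 (toggle {a, e} t) :=
      Computes.toggle_of_card_le_two (by simp [htc.1, htD.1]) Finset.card_le_two
    have hhe : ∀ x, h x e = x e := hS.apply_of_notMem (by simp [heD, hec])
    have hht : ∀ x, h x t = x t := hS.apply_of_notMem (by simp [htc.2, htD.2])
    have hha : ∀ x, h x a = x a := hS.apply_of_notMem (by simp [hac, haD])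
    have hfixc : ∀ x, ∀ i ∈ insert a c, (toggle c e * h) x i = x i := by
      intro x i hi
      rw [Equiv.Perm.mul_apply]
      rcases Finset.mem_insert.1 hi with rfl | hi
      · rw [toggle_apply_of_ne c hae, hha]
      · rw [toggle_apply_of_ne c (ne_of_mem_of_not_mem hi hec), hfix x i hi]
    have hsub : insert e (c ∪ D) ⊆ insert a c ∪ insert e D := by
      intro i; simp only [Finset.mem_insert, Finset.mem_union]; tauto
    refine ⟨toggle c e * h, hfixc, hT.mono hsub (by omega) (by omega), ?_⟩
    -- The middle factor changes `e` to `e ⊕ ⋀c`, so the two outer gates add `ae` and `a(e ⊕ ⋀c)` to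
    -- `t`. The sum is `a ∧ ⋀c`, whatever the initial value of `e`.
    have heq : toggle (insert a c) t * (toggle c e * h) =
        toggle {a, e} t * ((toggle c e * h) * toggle {a, e} t) := by
      have hta : t ∉ ({a, e} : Finset ι) := by simp [htc.1, htD.1]
      have htac : t ∉ insert a c := by simp [htc.1, htc.2]
      ext x j : 2
      simp only [Equiv.Perm.mul_apply]
      by_cases hjt : j = t
      · subst hjt
        have hk : ∀ i ∈ insert a c, toggle c e (h x) i = x i := hfixc x
        have hk' := hfixc (toggle {a, e} j x) a (Finset.mem_insert_self _ _)
        rw [Equiv.Perm.mul_apply] at hk'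
        rw [toggle_apply_self htac, toggle_apply_self hta, toggle_apply_of_ne c htD.1,
          toggle_apply_of_ne c htD.1, hht, hht, toggle_apply_self hta]
        simp only [Finset.mem_insert, Finset.mem_singleton, forall_eq_or_imp, forall_eq] at hk ⊢
        rw [hk', toggle_apply_self hec, hk.1, hhe, toggle_apply_of_ne _ (Ne.symm htc.1),
          toggle_apply_of_ne _ (Ne.symm htD.1)]
        have h1 : (∀ i ∈ c, toggle c e (h x) i = 1) ↔ ∀ i ∈ c, x i = 1 :=
          forall₂_congr fun i hi => by rw [hk.2 i hi]
        have h2 : (∀ i ∈ c, h (toggle {a, e} j x) i = 1) ↔ ∀ i ∈ c, x i = 1 :=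
          forall₂_congr fun i hi => by
            rw [hfix _ i hi, toggle_apply_of_ne _ (ne_of_mem_of_not_mem hi htc.2)]
        simp only [h1, h2]
        have hb : ∀ b : Fin 2, b = 0 ∨ b = 1 := by decide
        have hne : (0 : Fin 2) ≠ 1 := by decide
        have h11 : (1 : Fin 2) + 1 = 0 := by decide
        rcases hb (x a) with ha | ha <;> rcases hb (x e) with he | he <;>
          simp only [ha, he, hne, true_and, false_and, and_true, if_false, if_true, add_zero,
            zero_add, and_false] <;>
          by_cases hx : ∀ i ∈ c, x i = 1 <;>
          first
          | (simp only [if_pos hx, hne, h11, if_true, if_false, add_zero, add_assoc]; done)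
          | simp only [if_neg hx, hne, h11, if_true, if_false, add_zero, add_assoc, eq_self]
      · have hloc := hT.isLocal
        rw [toggle_apply_of_ne _ hjt, toggle_apply_of_ne _ hjt]
        by_cases hj : j ∈ insert e (c ∪ D)
        · refine hloc.congr _ _ (fun i hi => (toggle_apply_of_ne _ ?_ x).symm) j hj
          rintro rfl
          simp [htD.1, htD.2, htc.2] at hi
        · have e1 := hloc.apply_of_notMem x j hj
          have e2 := hloc.apply_of_notMem (toggle {a, e} t x) j hj
          rw [Equiv.Perm.mul_apply] at e1 e2
          rw [e1, e2, toggle_apply_of_ne _ hjt]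
    have hs1 : insert e (c ∪ D) ⊆ insert t (insert a c ∪ insert e D) :=
      hsub.trans (Finset.subset_insert _ _)
    have hs2 : ({t, a, e} : Finset ι) ⊆ insert t (insert a c ∪ insert e D) := by
      intro i; simp only [Finset.mem_insert, Finset.mem_union, Finset.mem_singleton]; tauto
    rw [heq]
    have ht' := htoggle.mono hs2 le_rfl le_rfl
    exact ((ht'.mul (hT.mono hs1 le_rfl le_rfl)).mul ht').mono le_rfl (by omega) (by omega)

/-- A NOT gate with many controls, with the help of qubits `D` in an arbitrary state. -/
theorem Computes.toggle {c D : Finset ι} {t : ι} (hcD : Disjoint c D) (htc : t ∉ c) (htD : t ∉ D)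
    (hcard : c.card ≤ D.card + 2) :
    Computes (insert t (c ∪ D)) (60 * c.card + 15) (60 * c.card + 15) (toggle c t) := by
  by_cases hc : c.card ≤ 2
  · exact (Computes.toggle_of_card_le_two htc hc).mono
      (Finset.insert_subset_insert _ Finset.subset_union_left) (by omega) (by omega)
  obtain ⟨D', hD', hDcard⟩ := Finset.exists_subset_card_eq (show c.card - 2 ≤ D.card by omega)
  obtain ⟨h, -, h1, h2⟩ := exists_ladder (c.card - 2) c D' t (hcD.mono_right hD') htc
    (fun h => htD (hD' h)) (by omega) hDcard
  have hsub : insert t (c ∪ D') ⊆ insert t (c ∪ D) :=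
    Finset.insert_subset_insert _ (Finset.union_subset_union_right hD')
  -- The ladder performs the toggle together with the disturbance `h` of the borrowed qubits;
  -- running `h⁻¹` first cancels the disturbance.
  have := (h1.inv.mono (Finset.subset_insert t _) le_rfl le_rfl).mul h2
  rw [mul_assoc, mul_inv_cancel, mul_one] at this
  exact this.mono hsub (by omega) (by omega)

end Computes

/-! ### Absorbing controls into clean flags, and merging flags. -/

section Absorption

variable {ι : Type*} [Fintype ι] [DecidableEq ι]

theorem exists_flip (X : Finset ι) : ∃ f : Equiv.Perm (ι → Fin 2),
    Computes X 15 (15 * X.card) f ∧ ∀ x, ∀ i ∈ X, f x i = x i + 1 := by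
  induction X using Finset.induction_on with
  | empty => exact ⟨1, (Computes.one _).mono le_rfl (Nat.zero_le _) le_rfl, by simp⟩
  | insert a X ha ih =>
    obtain ⟨f, hf, hfX⟩ := ih
    have ht : Computes {a} 15 15 (toggle ∅ a) :=
      Computes.toggle_of_card_le_two (Finset.notMem_empty a) (by simp)
    refine ⟨f * toggle ∅ a, ?_, fun x i hi => ?_⟩
    · rw [Finset.insert_eq, Finset.card_union_of_disjoint (by simpa using ha)]
      exact (ht.parallel (by simpa using ha) hf).mono le_rfl (by simp)
        (by rw [Finset.card_singleton]; omega)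
    · rw [Equiv.Perm.mul_apply]
      rcases Finset.mem_insert.1 hi with rfl | hi
      · rw [hf.apply_of_notMem ha, toggle_apply_self (Finset.notMem_empty _)]
        simp
      · rw [hfX _ i hi, toggle_apply_of_ne _ (ne_of_mem_of_not_mem hi ha)]

/-- The NOT gate with three controls borrows the single qubit `r` and restores it. Flipping `X`
afterwards makes it conditionally clean: if `a` starts at 0 and ends at 1, then `X` was all 1 and is
now all 0. The costs are `60 * 3 + 15` plus 15 layers or 45 gates for the flips. -/
theorem exists_absorb_three {X : Finset ι} {a r : ι} (hX : X.card = 3) (haX : a ∉ X) (hrX : r ∉ X)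
    (har : a ≠ r) : ∃ f : Equiv.Perm (ι → Fin 2), Computes ({a, r} ∪ X) 210 240 f ∧
      ∀ x, f x a = x a + (if ∀ i ∈ X, x i = 1 then 1 else 0) ∧ f x r = x r ∧
        ∀ i ∈ X, f x i = x i + 1 := by
  obtain ⟨f, hf, hfX⟩ := exists_flip X
  have ht : Computes (insert a (X ∪ {r})) _ _ (toggle X a) :=
    Computes.toggle (D := {r}) (by simpa using hrX) haX (by simpa using har) (by simp [hX])
  rw [hX] at ht hf
  have hsub : insert a (X ∪ {r}) ⊆ {a, r} ∪ X := by
    intro i; simp only [Finset.mem_insert, Finset.mem_union, Finset.mem_singleton]; tauto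
  refine ⟨f * toggle X a, ((ht.mono hsub le_rfl le_rfl).mul
    (hf.mono Finset.subset_union_right le_rfl le_rfl)).mono le_rfl (by norm_num) (by norm_num),
    fun x => ⟨?_, ?_, fun i hi => ?_⟩⟩
  · rw [Equiv.Perm.mul_apply, hf.apply_of_notMem haX, toggle_apply_self haX]
    congr
  · rw [Equiv.Perm.mul_apply, hf.apply_of_notMem hrX, toggle_apply_of_ne _ har.symm]
  · rw [Equiv.Perm.mul_apply, hfX _ i hi, toggle_apply_of_ne _ (ne_of_mem_of_not_mem hi haX)]

/-- With `2 * b` clean qubits `A`, half of which serve as a reserve, `3 * b` qubits `X` are absorbed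
into `b` flags in constant depth. -/
theorem exists_absorb (b : ℕ) : ∀ A X : Finset ι, Disjoint A X → A.card = 2 * b → X.card = 3 * b →
    ∃ (f : Equiv.Perm (ι → Fin 2)) (G R : Finset ι), G ⊆ A ∧ R ⊆ A ∧ Disjoint G R ∧
      G.card = b ∧ R.card = b ∧ Computes (A ∪ X) 210 (240 * b) f ∧
      ∀ x, (∀ i ∈ A, x i = 0) → ((∀ g ∈ G, f x g = 1) ↔ ∀ i ∈ X, x i = 1) ∧
        (∀ i ∈ R, f x i = 0) ∧ ∀ i ∈ X, f x i = x i + 1 := by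
  induction b with
  | zero =>
    intro A X _ hA hX
    obtain rfl := Finset.card_eq_zero.1 hA
    obtain rfl := Finset.card_eq_zero.1 hX
    exact ⟨1, ∅, ∅, by simp, by simp, by simp, rfl, rfl,
      (Computes.one _).mono le_rfl (Nat.zero_le _) le_rfl, by simp⟩
  | succ b ih =>
    intro A X hAX hA hX
    obtain ⟨A₁, hA₁, hA₁c⟩ := Finset.exists_subset_card_eq (show 2 ≤ A.card by omega)
    obtain ⟨X₁, hX₁, hX₁c⟩ := Finset.exists_subset_card_eq (show 3 ≤ X.card by omega)
    -- In each block `a` becomes the flag, while `r` is only borrowed, so it is still clean for the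
    -- merge.
    obtain ⟨a, r, har, rfl⟩ := Finset.card_eq_two.1 hA₁c
    have haA : a ∈ A := hA₁ (by simp)
    have hrA : r ∈ A := hA₁ (by simp)
    have hA₂c := Finset.card_sdiff_of_subset hA₁
    have hX₂c := Finset.card_sdiff_of_subset hX₁
    obtain ⟨f₂, G, R, hG, hR, hGR, hGc, hRc, hf₂, hspec₂⟩ := ih (A \ {a, r}) (X \ X₁)
      (hAX.mono Finset.sdiff_subset Finset.sdiff_subset) (by omega) (by omega)
    obtain ⟨f₁, hf₁, hspec₁⟩ := exists_absorb_three hX₁c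
      (fun h => Finset.disjoint_left.1 hAX haA (hX₁ h))
      (fun h => Finset.disjoint_left.1 hAX hrA (hX₁ h)) har
    have haG : a ∉ G := fun h => by simpa using hG h
    have hrG : r ∉ G := fun h => by simpa using hG h
    have haR : a ∉ R := fun h => by simpa using hR h
    have hrR : r ∉ R := fun h => by simpa using hR h
    have hdisj : Disjoint ({a, r} ∪ X₁) (A \ {a, r} ∪ X \ X₁) := by
      rw [Finset.disjoint_union_left, Finset.disjoint_union_right, Finset.disjoint_union_right]
      exact ⟨⟨Finset.disjoint_sdiff, hAX.mono hA₁ Finset.sdiff_subset⟩,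
        (hAX.mono Finset.sdiff_subset hX₁).symm, Finset.disjoint_sdiff⟩
    have hsub : ({a, r} ∪ X₁) ∪ (A \ {a, r} ∪ X \ X₁) ⊆ A ∪ X := by
      intro i hi
      simp only [Finset.mem_union, Finset.mem_sdiff] at hi ⊢
      rcases hi with (hi | hi) | hi | hi
      · exact Or.inl (hA₁ hi)
      · exact Or.inr (hX₁ hi)
      · exact Or.inl hi.1
      · exact Or.inr hi.1
    refine ⟨f₂ * f₁, insert a G, insert r R,
      Finset.insert_subset haA (hG.trans Finset.sdiff_subset),
      Finset.insert_subset hrA (hR.trans Finset.sdiff_subset), ?_,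
      by rw [Finset.card_insert_of_notMem haG, hGc], by rw [Finset.card_insert_of_notMem hrR, hRc],
      (hf₁.parallel hdisj hf₂).mono hsub (by simp) (by omega), fun x hx => ?_⟩
    · simp only [Finset.disjoint_insert_left, Finset.disjoint_insert_right, Finset.mem_insert,
        not_or]
      exact ⟨⟨har.symm, hrG⟩, haR, hGR⟩
    have hout : ∀ i ∈ {a, r} ∪ X₁, f₂ (f₁ x) i = f₁ x i := fun i hi =>
      hf₂.apply_of_notMem (Finset.disjoint_left.1 hdisj hi) _
    have hin : ∀ i ∈ A \ {a, r} ∪ X \ X₁, f₁ x i = x i := fun i hi =>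
      hf₁.apply_of_notMem (Finset.disjoint_right.1 hdisj hi) _
    obtain ⟨e₁, e₂, e₃⟩ := hspec₁ x
    obtain ⟨g₁, g₂, g₃⟩ := hspec₂ (f₁ x) fun i hi => by
      rw [hin i (Finset.mem_union_left _ hi), hx i (Finset.sdiff_subset hi)]
    simp only [Equiv.Perm.mul_apply]
    refine ⟨?_, fun i hi => ?_, fun i hi => ?_⟩
    · rw [Finset.forall_mem_insert, g₁, hout a (by simp), e₁, hx a haA, zero_add]
      have h1 : (∀ i ∈ X \ X₁, f₁ x i = 1) ↔ ∀ i ∈ X \ X₁, x i = 1 :=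
        forall₂_congr fun i hi => by rw [hin i (Finset.mem_union_right _ hi)]
      rw [h1, ← Finset.union_sdiff_of_subset hX₁, Finset.forall_mem_union,
        Finset.union_sdiff_of_subset hX₁]
      by_cases h : ∀ i ∈ X₁, x i = 1 <;> simp [h]
    · rcases Finset.mem_insert.1 hi with rfl | hi
      · rw [hout i (by simp), e₂, hx i hrA]
      · exact g₂ i hi
    · by_cases hi1 : i ∈ X₁
      · rw [hout i (Finset.mem_union_right _ hi1), e₃ i hi1]
      · have hi2 : i ∈ X \ X₁ := Finset.mem_sdiff.2 ⟨hi, hi1⟩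
        rw [g₃ i hi2, hin i (Finset.mem_union_right _ hi2)]

/-- The conjunction of the flags `G` is computed in logarithmic depth with clean qubits `R`. -/
theorem exists_merge (k : ℕ) : ∀ G R : Finset ι, Disjoint G R → G.Nonempty → G.card ≤ 2 ^ k →
    G.card ≤ R.card + 1 →
    ∃ (f : Equiv.Perm (ι → Fin 2)) (g : ι), g ∈ G ∪ R ∧
      Computes (G ∪ R) (15 * k) (15 * (G.card - 1)) f ∧
      ∀ x, (∀ i ∈ R, x i = 0) → (f x g = 1 ↔ ∀ i ∈ G, x i = 1) := by
  have single : ∀ (k : ℕ) (G R : Finset ι), G.card = 1 →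
      ∃ (f : Equiv.Perm (ι → Fin 2)) (g : ι), g ∈ G ∪ R ∧
      Computes (G ∪ R) (15 * k) (15 * (G.card - 1)) f ∧
      ∀ x, (∀ i ∈ R, x i = 0) → (f x g = 1 ↔ ∀ i ∈ G, x i = 1) := by
    intro k G R hG
    obtain ⟨g, rfl⟩ := Finset.card_eq_one.1 hG
    exact ⟨1, g, by simp, (Computes.one _).mono le_rfl (Nat.zero_le _) (Nat.zero_le _), by simp⟩
  induction k with
  | zero =>
    intro G R _ hne hG _
    exact single 0 G R (le_antisymm (by simpa using hG) hne.card_pos)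
  | succ k ih =>
    intro G R hGR hne hG hR
    by_cases hG1 : G.card = 1
    · exact single _ G R hG1
    have hpos := hne.card_pos
    rw [pow_succ] at hG
    obtain ⟨G₁, hG₁, hG₁c⟩ := Finset.exists_subset_card_eq (show G.card / 2 ≤ G.card by omega)
    have hG₂c := Finset.card_sdiff_of_subset hG₁
    set G₂ := G \ G₁ with hG₂
    -- A binary tree with `|G|` leaves has `|G| - 1` inner nodes, each needing a clean target:
    -- `(|G₁| - 1) + (|G₂| - 1)` for the two subtrees and one, `r`, for the root.
    obtain ⟨R₁, hR₁, hR₁c⟩ := Finset.exists_subset_card_eq (show G₁.card - 1 ≤ R.card by omega)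
    have hRc := Finset.card_sdiff_of_subset hR₁
    obtain ⟨R₂, hR₂, hR₂c⟩ := Finset.exists_subset_card_eq
      (show G₂.card - 1 ≤ (R \ R₁).card by omega)
    have hRc' := Finset.card_sdiff_of_subset hR₂
    obtain ⟨r, hr⟩ : ((R \ R₁) \ R₂).Nonempty := Finset.card_pos.1 (by omega)
    simp only [Finset.mem_sdiff] at hr
    have hR₂R : R₂ ⊆ R := hR₂.trans Finset.sdiff_subset
    have hG₂G : G₂ ⊆ G := Finset.sdiff_subset
    obtain ⟨f₁, g₁, hg₁, hf₁, hs₁⟩ := ih G₁ R₁ (hGR.mono hG₁ hR₁)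
      (Finset.card_pos.1 (by omega)) (by omega) (by omega)
    obtain ⟨f₂, g₂, hg₂, hf₂, hs₂⟩ := ih G₂ R₂ (hGR.mono hG₂G hR₂R)
      (Finset.card_pos.1 (by omega)) (by omega) (by omega)
    have hdisj : Disjoint (G₁ ∪ R₁) (G₂ ∪ R₂) := by
      rw [Finset.disjoint_union_left, Finset.disjoint_union_right, Finset.disjoint_union_right]
      exact ⟨⟨Finset.disjoint_sdiff, hGR.mono hG₁ hR₂R⟩, (hGR.mono hG₂G hR₁).symm,
        Finset.disjoint_sdiff.mono_right hR₂⟩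
    have hrG : r ∉ G := Finset.disjoint_right.1 hGR hr.1.1
    have hr₁ : r ∉ G₁ ∪ R₁ := by
      simp only [Finset.mem_union, not_or]
      exact ⟨fun h => hrG (hG₁ h), hr.1.2⟩
    have hr₂ : r ∉ G₂ ∪ R₂ := by
      simp only [Finset.mem_union, not_or]
      exact ⟨fun h => hrG (hG₂G h), hr.2⟩
    have hrg : r ∉ ({g₁, g₂} : Finset ι) := by
      simp only [Finset.mem_insert, Finset.mem_singleton, not_or]
      exact ⟨fun h => hr₁ (h ▸ hg₁), fun h => hr₂ (h ▸ hg₂)⟩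
    have hsub₁ : G₁ ∪ R₁ ⊆ G ∪ R := Finset.union_subset_union hG₁ hR₁
    have hsub₂ : G₂ ∪ R₂ ⊆ G ∪ R := Finset.union_subset_union hG₂G hR₂R
    have hrS : r ∈ G ∪ R := Finset.mem_union_right _ hr.1.1
    have ht : Computes (insert r {g₁, g₂}) 15 15 (toggle {g₁, g₂} r) :=
      Computes.toggle_of_card_le_two hrg Finset.card_le_two
    refine ⟨toggle {g₁, g₂} r * (f₂ * f₁), r, hrS,
      (((hf₁.parallel hdisj hf₂).mono (Finset.union_subset hsub₁ hsub₂) le_rfl le_rfl).mul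
        (ht.mono ?_ le_rfl le_rfl)).mono le_rfl (by rw [max_self]; omega) (by omega),
      fun x hx => ?_⟩
    · simp only [Finset.insert_subset_iff, Finset.singleton_subset_iff]
      exact ⟨hrS, hsub₁ hg₁, hsub₂ hg₂⟩
    have e₁ : f₂ (f₁ x) g₁ = f₁ x g₁ := hf₂.apply_of_notMem (Finset.disjoint_left.1 hdisj hg₁) _
    have hin : ∀ i ∈ G₂ ∪ R₂, f₁ x i = x i := fun i hi =>
      hf₁.apply_of_notMem (Finset.disjoint_right.1 hdisj hi) _
    have e₂ := hs₂ (f₁ x) fun i hi => by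
      rw [hin i (Finset.mem_union_right _ hi), hx i (hR₂R hi)]
    have e₃ : (∀ i ∈ G₂, f₁ x i = 1) ↔ ∀ i ∈ G₂, x i = 1 :=
      forall₂_congr fun i hi => by rw [hin i (Finset.mem_union_left _ hi)]
    rw [e₃] at e₂
    simp only [Equiv.Perm.mul_apply]
    rw [toggle_apply_self hrg, hf₂.apply_of_notMem hr₂, hf₁.apply_of_notMem hr₁, hx r hr.1.1,
      zero_add]
    simp only [Finset.mem_insert, Finset.mem_singleton, forall_eq_or_imp, forall_eq]
    have key : (f₂ (f₁ x) g₁ = 1 ∧ f₂ (f₁ x) g₂ = 1) ↔ ∀ i ∈ G, x i = 1 := by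
      rw [e₁, e₂, hs₁ x fun i hi => hx i (hR₁ hi), ← Finset.forall_mem_union, hG₂,
        Finset.union_sdiff_of_subset hG₁]
    rw [← key]
    split_ifs with h <;> simp [h]

end Absorption

/-! ### Iterated absorption with postponed merges. -/

section Conjunction

variable {ι : Type*} [Fintype ι] [DecidableEq ι]

/-- An intermediate state of the computation of the conjunction of the qubits in `C` : the qubits in
`C \ B` are absorbed into the flags `F`, and if all the flags are at `|1⟩` then the qubits in `A`
are clean. The qubit `r` is clean as soon as `a` is at `|1⟩`. -/
structure AbsorbedInto (C : Finset ι) (a r : ι) (l k : ℕ) (B A F S : Finset ι)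
    (p q : Equiv.Perm (ι → Fin 2)) : Prop where
  computes_left : Computes (insert a C) (210 * (k + 1)) (240 * (C \ B).card) p
  computes_right : Computes S (15 * l) (15 * (C \ B).card) q
  left_apply : ∀ x, ∀ i ∈ B, p x i = x i
  subset_right : S ⊆ insert a C
  remaining_subset : B ⊆ C
  clean_subset : A ⊆ C
  flags_subset : F ⊆ insert a C
  disjoint_remaining_right : Disjoint B S
  disjoint_clean_right : Disjoint A S
  disjoint_clean_remaining : Disjoint A B
  disjoint_flags_clean : Disjoint F A
  disjoint_flags_remaining : Disjoint F B
  anc_mem : a ∈ F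
  reserved_mem : r ∈ C
  reserved_notMem_flags : r ∉ F
  reserved_notMem_clean : r ∉ A
  reserved_notMem_remaining : r ∉ B
  card_flags_lt : F.card < A.card
  card_flags_le : F.card ≤ k + 1
  growth : 2 * 4 ^ k ≤ 3 ^ k * A.card ∨ B.card < 3
  flags_iff : ∀ x, x a = 0 → ((∀ i ∈ F, q (p x) i = 1) ↔ ∀ i ∈ C \ B, x i = 1)
  clean : ∀ x, x a = 0 → (∀ i ∈ F, q (p x) i = 1) → ∀ i ∈ A, q (p x) i = 0
  reserved : ∀ x, x a = 0 → q (p x) a = 1 → q (p x) r = 0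

/-- The first block of three controls is absorbed into the true ancilla, borrowing a fourth control
`e`; hence the bound 4. Of the three conditionally clean qubits, `r` is set aside for the final gate
and two form the first supply. -/
theorem exists_absorbedInto_zero {C : Finset ι} {a : ι} (ha : a ∉ C) (hC : 4 ≤ C.card) (l : ℕ) :
    ∃ r B A F S p q, AbsorbedInto C a r l 0 B A F S p q := by
  obtain ⟨X, hX, hXc⟩ := Finset.exists_subset_card_eq (show 3 ≤ C.card by omega)
  have hBc := Finset.card_sdiff_of_subset hX
  obtain ⟨e, he⟩ : (C \ X).Nonempty := Finset.card_pos.1 (by omega)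
  rw [Finset.mem_sdiff] at he
  obtain ⟨r, A, hrA, rfl, hA⟩ := Finset.card_eq_succ.1 hXc
  have haX : a ∉ insert r A := fun h => ha (hX h)
  obtain ⟨p, hp, hspec⟩ := exists_absorb_three hXc haX he.2 (fun h => ha (h ▸ he.1))
  have hCX : C \ (C \ insert r A) = insert r A := by
    exact Finset.sdiff_sdiff_eq_self hX
  have har : r ≠ a := fun h => haX (by simp [h])
  have haA : a ∉ A := fun h => haX (by simp [h])
  have h11 : (1 : Fin 2) + 1 = 0 := by decide
  have hflag : ∀ x : ι → Fin 2, x a = 0 → (p x a = 1 ↔ ∀ i ∈ insert r A, x i = 1) := by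
    intro x hx
    rw [(hspec x).1, hx, zero_add]
    split_ifs with h
    · exact iff_of_true rfl h
    · exact iff_of_false (by decide) h
  have hzero : ∀ x : ι → Fin 2, x a = 0 → p x a = 1 → ∀ i ∈ insert r A, p x i = 0 := by
    intro x hx hpx i hi
    rw [(hspec x).2.2 i hi, (hflag x hx).1 hpx i hi, h11]
  refine ⟨r, C \ insert r A, A, {a}, ∅, p, 1, ⟨?_, ?_, ?_, by simp, Finset.sdiff_subset, ?_,
    by simp, by simp, by simp, ?_, by simpa using haA, ?_, by simp, hX (by simp), by simpa using har,
    hrA, by simp, ?_, by simp, ?_, ?_, ?_, ?_⟩⟩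
  · rw [hCX, hXc]
    refine hp.mono ?_ (by norm_num) (by norm_num)
    rw [Finset.union_subset_iff, Finset.insert_subset_iff, Finset.singleton_subset_iff]
    exact ⟨⟨by simp, Finset.mem_insert_of_mem he.1⟩, hX.trans (Finset.subset_insert _ _)⟩
  · exact (Computes.one _).mono le_rfl (Nat.zero_le _) (Nat.zero_le _)
  · intro x i hi
    rw [Finset.mem_sdiff] at hi
    by_cases hie : i = e
    · rw [hie, (hspec x).2.1]
    · refine hp.apply_of_notMem ?_ x
      simp only [Finset.mem_union, Finset.mem_insert, Finset.mem_singleton, not_or] at hi ⊢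
      exact ⟨⟨fun h => ha (h ▸ hi.1), hie⟩, hi.2⟩
  · exact (Finset.subset_insert _ _).trans hX
  · exact Finset.disjoint_sdiff.mono_left (Finset.subset_insert _ _)
  · simp [ha]
  · rw [hA]; simp
  · left; rw [hA]; norm_num
  · intro x hx
    rw [hCX, ← hflag x hx]
    simp
  · intro x hx h i hi
    exact hzero x hx (by simpa using h) i (Finset.mem_insert_of_mem hi)
  · intro x hx h
    exact hzero x hx h r (Finset.mem_insert_self _ _)

/-- The new absorption `f` is appended to `p` and the new merge `m` to `q`. Consumed clean qubits
leave the supply and the absorbed controls enter it, a net gain of `b`. -/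
theorem AbsorbedInto.exists_succ {C : Finset ι} {a r : ι} {l k : ℕ} {B A F S : Finset ι}
    {p q : Equiv.Perm (ι → Fin 2)} (h : AbsorbedInto C a r l k B A F S p q) (hl : C.card ≤ 2 ^ l) :
    ∃ B A F S p q, AbsorbedInto C a r l (k + 1) B A F S p q := by
  by_cases hB : B.card < 3
  · exact ⟨B, A, F, S, p, q, { h with
      computes_left := h.computes_left.mono le_rfl (by omega) le_rfl
      card_flags_le := h.card_flags_le.trans (by omega)
      growth := Or.inr hB }⟩
  -- The largest number of blocks allowed by the clean qubits (two per block) and by the remaining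
  -- controls (three per block).
  obtain ⟨b, hb, hbA, hbB⟩ : ∃ b, b = min (A.card / 2) (B.card / 3) ∧ 2 * b ≤ A.card ∧
    3 * b ≤ B.card := ⟨_, rfl, by omega, by omega⟩
  have hA2 : 2 ≤ A.card := by
    have := Finset.card_pos.2 ⟨a, h.anc_mem⟩
    have := h.card_flags_lt
    omega
  have hb1 : 1 ≤ b := by omega
  obtain ⟨A', hA', hA'c⟩ := Finset.exists_subset_card_eq hbA
  obtain ⟨X, hX, hXc⟩ := Finset.exists_subset_card_eq hbB
  have hXC := hX.trans h.remaining_subset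
  have hA'C := hA'.trans h.clean_subset
  obtain ⟨f, G, R, hG, hR, hGR, hGc, hRc, hf, hfs⟩ := exists_absorb b A' X
    (h.disjoint_clean_remaining.mono hA' hX) hA'c hXc
  have hbl : b ≤ 2 ^ l := (by have := Finset.card_le_card hXC; omega : b ≤ C.card).trans hl
  obtain ⟨m, g, hg, hm, hms⟩ := exists_merge l G R hGR (Finset.card_pos.1 (by omega)) (by omega)
    (by omega)
  have hGRA : G ∪ R ⊆ A' := Finset.union_subset hG hR
  have hgA : g ∈ A := hA' (hGRA hg)
  have hgF : g ∉ F := Finset.disjoint_right.1 h.disjoint_flags_clean hgA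
  have hXS : Disjoint X S := h.disjoint_remaining_right.mono_left hX
  have hA'S : Disjoint A' S := h.disjoint_clean_right.mono_left hA'
  -- This allows the merges to be postponed: the absorption runs before `q`, yet may be analysed as
  -- if it ran after `q`, when the earlier flags are available as hypotheses.
  have hfq : Commute f q := hf.isLocal.commute h.computes_right.isLocal
    (Finset.disjoint_union_left.2 ⟨hA'S, hXS⟩)
  have hCB : C \ (B \ X) = C \ B ∪ X := by
    ext i
    simp only [Finset.mem_sdiff, Finset.mem_union, not_and, not_not]
    constructor
    · rintro ⟨h1, h2⟩
      by_cases hi : i ∈ B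
      · exact Or.inr (h2 hi)
      · exact Or.inl ⟨h1, hi⟩
    · rintro (⟨h1, h2⟩ | h1)
      · exact ⟨h1, fun h => absurd h h2⟩
      · exact ⟨hXC h1, fun _ => h1⟩
  have hCBc : (C \ (B \ X)).card = (C \ B).card + 3 * b := by
    rw [hCB, Finset.card_union_of_disjoint (Finset.sdiff_disjoint.mono_right hX), hXc]
  have hAAX : Disjoint (A \ A') X := h.disjoint_clean_remaining.mono Finset.sdiff_subset hX
  have hA1c : (A \ A' ∪ X).card = A.card + b := by
    rw [Finset.card_union_of_disjoint hAAX, Finset.card_sdiff_of_subset hA', hA'c, hXc]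
    omega
  have hFA' : ∀ i ∈ F, i ∉ A' ∪ X := fun i hi => by
    rw [Finset.mem_union, not_or]
    exact ⟨fun h' => Finset.disjoint_left.1 h.disjoint_flags_clean hi (hA' h'),
      fun h' => Finset.disjoint_left.1 h.disjoint_flags_remaining hi (hX h')⟩
  have hrA' : r ∉ A' ∪ X := by
    rw [Finset.mem_union, not_or]
    exact ⟨fun h' => h.reserved_notMem_clean (hA' h'), fun h' => h.reserved_notMem_remaining (hX h')⟩
  have hout : ∀ i ∉ A' ∪ X, ∀ y, m (f y) i = y i := fun i hi y => by
    rw [hm.apply_of_notMem (fun h' => hi (Finset.mem_union_left _ (hGRA h'))),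
      hf.apply_of_notMem hi]
  have hswap : ∀ x, (m * q) ((f * p) x) = m (f (q (p x))) := fun x => by
    have := congrArg (fun e : Equiv.Perm (ι → Fin 2) => e (p x)) hfq.eq
    simp only [Equiv.Perm.mul_apply] at this ⊢
    rw [this]
  have hflag : ∀ x, (∀ i ∈ F, (m * q) ((f * p) x) i = 1) ↔ ∀ i ∈ F, q (p x) i = 1 := fun x =>
    forall₂_congr fun i hi => by rw [hswap, hout i (hFA' i hi)]
  have hqX : ∀ x, ∀ i ∈ X, q (p x) i = x i := fun x i hi => by
    rw [h.computes_right.apply_of_notMem (Finset.disjoint_left.1 hXS hi), h.left_apply x i (hX hi)]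
  have hgspec : ∀ x, x a = 0 → (∀ i ∈ F, q (p x) i = 1) →
      ((m * q) ((f * p) x) g = 1 ↔ ∀ i ∈ X, x i = 1) := fun x hx hF => by
    obtain ⟨e₁, e₂, -⟩ := hfs (q (p x)) fun i hi => h.clean x hx hF i (hA' hi)
    rw [hswap, hms _ e₂, e₁]
    exact forall₂_congr fun i hi => by rw [hqX x i hi]
  have h11 : (1 : Fin 2) + 1 = 0 := by decide
  refine ⟨B \ X, A \ A' ∪ X, insert g F, S ∪ (G ∪ R), f * p, m * q, ?_⟩
  constructor
  · rw [hCBc]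
    exact (h.computes_left.mul (hf.mono ((Finset.union_subset hA'C hXC).trans
      (Finset.subset_insert _ _)) le_rfl le_rfl)).mono le_rfl (by omega) (by omega)
  · rw [hCBc]
    exact (h.computes_right.parallel (hA'S.mono_left hGRA).symm hm).mono le_rfl (by simp)
      (by omega)
  · intro x i hi
    rw [Finset.mem_sdiff] at hi
    rw [Equiv.Perm.mul_apply, hf.apply_of_notMem, h.left_apply x i hi.1]
    rw [Finset.mem_union, not_or]
    exact ⟨fun h' => Finset.disjoint_left.1 h.disjoint_clean_remaining (hA' h') hi.1, hi.2⟩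
  · exact Finset.union_subset h.subset_right
      ((hGRA.trans hA'C).trans (Finset.subset_insert _ _))
  · exact Finset.sdiff_subset.trans h.remaining_subset
  · exact Finset.union_subset (Finset.sdiff_subset.trans h.clean_subset) hXC
  · exact Finset.insert_subset (Finset.mem_insert_of_mem (h.clean_subset hgA)) h.flags_subset
  · rw [Finset.disjoint_union_right]
    exact ⟨h.disjoint_remaining_right.mono_left Finset.sdiff_subset,
      (h.disjoint_clean_remaining.mono (hGRA.trans hA') Finset.sdiff_subset).symm⟩
  · exact Finset.disjoint_union_left.2 ⟨Finset.disjoint_union_right.2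
      ⟨h.disjoint_clean_right.mono_left Finset.sdiff_subset,
        Finset.sdiff_disjoint.mono_right hGRA⟩, Finset.disjoint_union_right.2
      ⟨hXS, (h.disjoint_clean_remaining.mono (hGRA.trans hA') hX).symm⟩⟩
  · rw [Finset.disjoint_union_left]
    exact ⟨h.disjoint_clean_remaining.mono Finset.sdiff_subset Finset.sdiff_subset,
      Finset.disjoint_sdiff⟩
  · rw [Finset.disjoint_insert_left, Finset.disjoint_union_right]
    refine ⟨?_, h.disjoint_flags_clean.mono_right Finset.sdiff_subset,
      h.disjoint_flags_remaining.mono_right hX⟩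
    simp only [Finset.mem_union, Finset.mem_sdiff, not_or, not_and, not_not]
    exact ⟨fun _ => hGRA hg, fun h' => Finset.disjoint_left.1 h.disjoint_clean_remaining hgA (hX h')⟩
  · rw [Finset.disjoint_insert_left]
    exact ⟨fun h' => Finset.disjoint_left.1 h.disjoint_clean_remaining hgA
      (Finset.sdiff_subset h'), h.disjoint_flags_remaining.mono_right Finset.sdiff_subset⟩
  · exact Finset.mem_insert_of_mem h.anc_mem
  · exact h.reserved_mem
  · rw [Finset.mem_insert, not_or]
    exact ⟨fun h' => h.reserved_notMem_clean (h' ▸ hgA), h.reserved_notMem_flags⟩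
  · rw [Finset.mem_union, not_or] at hrA' ⊢
    exact ⟨fun h' => h.reserved_notMem_clean (Finset.sdiff_subset h'), hrA'.2⟩
  · exact fun h' => h.reserved_notMem_remaining (Finset.sdiff_subset h')
  · rw [hA1c, Finset.card_insert_of_notMem hgF]
    have := h.card_flags_lt
    omega
  · rw [Finset.card_insert_of_notMem hgF]
    have := h.card_flags_le
    omega
  · rcases h.growth with hgr | hgr
    · by_cases hcase : A.card / 2 ≤ B.card / 3
      · left
        rw [hA1c, pow_succ, pow_succ]
        -- Here `b = ⌊|A| / 2⌋`, which is at least `|A| / 3` since `|A| ≥ 2`; the case `|A| = 3` is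
        -- tight.
        have h1 : 4 * A.card ≤ 3 * (A.card + b) := by omega
        calc 2 * (4 ^ k * 4) = 4 * (2 * 4 ^ k) := by ring
          _ ≤ 4 * (3 ^ k * A.card) := Nat.mul_le_mul_left _ hgr
          _ = 3 ^ k * (4 * A.card) := by ring
          _ ≤ 3 ^ k * (3 * (A.card + b)) := Nat.mul_le_mul_left _ h1
          _ = 3 ^ k * 3 * (A.card + b) := by ring
      · right
        -- The controls are the bottleneck: `b = ⌊|B| / 3⌋`, and only the remainder modulo 3
        -- survives.
        rw [Finset.card_sdiff_of_subset hX, hXc]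
        omega
    · exact absurd hgr hB
  · intro x hx
    rw [Finset.forall_mem_insert, hflag, hCB, Finset.forall_mem_union, ← h.flags_iff x hx]
    constructor
    · rintro ⟨h1, h2⟩; exact ⟨h2, (hgspec x hx h2).1 h1⟩
    · rintro ⟨h1, h2⟩; exact ⟨(hgspec x hx h1).2 h2, h1⟩
  · intro x hx hF i hi
    rw [Finset.forall_mem_insert, hflag] at hF
    have hX1 := (hgspec x hx hF.2).1 hF.1
    rw [hswap]
    rcases Finset.mem_union.1 hi with hi | hi
    · rw [hout i, h.clean x hx hF.2 i (Finset.sdiff_subset hi)]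
      rw [Finset.mem_union, not_or]
      exact ⟨(Finset.mem_sdiff.1 hi).2, Finset.disjoint_left.1 hAAX hi⟩
    · have hiA : i ∉ G ∪ R := fun h' =>
        Finset.disjoint_left.1 h.disjoint_clean_remaining (hA' (hGRA h')) (hX hi)
      rw [hm.apply_of_notMem hiA, (hfs (q (p x)) fun i hi => h.clean x hx hF.2 i (hA' hi)).2.2 i hi,
        hqX x i hi, hX1 i hi, h11]
  · intro x hx
    rw [hswap, hout a (hFA' a h.anc_mem), hout r hrA']
    exact h.reserved x hx

/-- The conjunction of the qubits in `C`, in the form of the conjunction of two qubits. -/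
theorem exists_conjunction {C : Finset ι} {a : ι} (ha : a ∉ C) (hC : 4 ≤ C.card) {l : ℕ}
    (hl : C.card ≤ 2 ^ l) : ∃ r ∈ C, ∃ f : Equiv.Perm (ι → Fin 2),
      Computes (insert a C) (825 * l + 345) (315 * C.card + 15) f ∧
      ∀ x, x a = 0 → ((f x a = 1 ∧ f x r = 1) ↔ ∀ i ∈ C, x i = 1) := by
  have hstage : ∀ k, ∃ r B A F S p q, AbsorbedInto C a r l k B A F S p q := fun k => by
    induction k with
    | zero => exact exists_absorbedInto_zero ha hC l
    | succ k ih =>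
      obtain ⟨r, B, A, F, S, p, q, h⟩ := ih
      exact ⟨r, h.exists_succ hl⟩
  -- Since `(4/3)³ > 2`, growth through `3 * l` stages would give more than `2 ^ l` clean qubits,
  -- more than there are controls.
  obtain ⟨r, B, A, F, S, p, q, h⟩ := hstage (3 * l)
  have hAC := Finset.card_le_card h.clean_subset
  have hB : B.card < 3 := by
    refine h.growth.resolve_left fun hgr => ?_
    rw [pow_mul, pow_mul] at hgr
    have h1 : 2 * (27 ^ l * 2 ^ l) ≤ 27 ^ l * 2 ^ l := by
      rw [← mul_pow]
      calc 2 * (27 * 2) ^ l ≤ 2 * (4 ^ 3) ^ l :=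
            Nat.mul_le_mul_left _ (Nat.pow_le_pow_left (by norm_num) _)
        _ ≤ (3 ^ 3) ^ l * A.card := hgr
        _ ≤ 27 ^ l * 2 ^ l := Nat.mul_le_mul (by norm_num) (hAC.trans hl)
        _ = (27 * 2) ^ l := (mul_pow _ _ _).symm
    have h2 : 0 < 27 ^ l * 2 ^ l := by positivity
    omega
  set c := F.erase a ∪ B with hc
  have hFc : (F.erase a).card + 1 = F.card := Finset.card_erase_add_one h.anc_mem
  have hcc : c.card ≤ (F.erase a).card + B.card := Finset.card_union_le _ _
  have hF1 := h.card_flags_lt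
  have hF2 := h.card_flags_le
  have hCB := Finset.card_le_card (Finset.sdiff_subset (s := C) (t := B))
  have hcA : Disjoint c A := by
    rw [hc, Finset.disjoint_union_left]
    exact ⟨h.disjoint_flags_clean.mono_left (Finset.erase_subset _ _),
      h.disjoint_clean_remaining.symm⟩
  have hrc : r ∉ c := by
    rw [hc, Finset.mem_union, not_or]
    exact ⟨fun h' => h.reserved_notMem_flags (Finset.erase_subset _ _ h'),
      h.reserved_notMem_remaining⟩
  -- The supply `A` is merely borrowed, so its state is irrelevant. It is large enough because it
  -- exceeds the number of flags and at most two controls remain.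
  have ht := Computes.toggle hcA hrc h.reserved_notMem_clean (by omega)
  have hsub : insert r (c ∪ A) ⊆ insert a C := by
    refine Finset.insert_subset (Finset.mem_insert_of_mem h.reserved_mem) (Finset.union_subset
      (Finset.union_subset ((Finset.erase_subset _ _).trans h.flags_subset)
        (h.remaining_subset.trans (Finset.subset_insert _ _)))
      (h.clean_subset.trans (Finset.subset_insert _ _)))
  have har : a ≠ r := fun h' => ha (h' ▸ h.reserved_mem)
  refine ⟨r, h.reserved_mem, toggle c r * (q * p), ((h.computes_left.mul
    (h.computes_right.mono h.subset_right le_rfl le_rfl)).mul (ht.mono hsub le_rfl le_rfl)).mono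
    le_rfl (by omega) (by omega), fun x hx => ?_⟩
  simp only [Equiv.Perm.mul_apply]
  rw [toggle_apply_of_ne _ har, toggle_apply_self hrc]
  have hBx : (∀ i ∈ B, q (p x) i = 1) ↔ ∀ i ∈ B, x i = 1 := forall₂_congr fun i hi => by
    rw [h.computes_right.apply_of_notMem (Finset.disjoint_left.1 h.disjoint_remaining_right hi),
      h.left_apply x i hi]
  have hall : (q (p x) a = 1 ∧ ∀ i ∈ c, q (p x) i = 1) ↔ ∀ i ∈ C, x i = 1 := by
    rw [hc, Finset.forall_mem_union, ← and_assoc,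
      ← Finset.forall_mem_insert a (F.erase a) fun i => q (p x) i = 1,
      Finset.insert_erase h.anc_mem, h.flags_iff x hx, hBx, ← Finset.forall_mem_union,
      Finset.sdiff_union_of_subset h.remaining_subset]
  rw [← hall]
  -- The value of `r` matters only when `a` is at 1, and in that case `r` was clean before the last
  -- gate.
  refine and_congr_right fun h1 => ?_
  rw [h.reserved x hx h1, zero_add]
  split_ifs with h2
  · exact iff_of_true rfl h2
  · exact iff_of_false (by decide) h2

end Conjunction

/-! ### Compute the conjunction, apply the gate, uncompute. -/

section Implementation

/-- Fewer than four controls are treated by hand. A single control is paired with the ancilla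
flipped to 1, so that only zero or two controls ever occur; with three, two of them are absorbed
into `a`. -/
theorem exists_conjunction_of_two {ι : Type*} [Fintype ι] [DecidableEq ι] {C : Finset ι} {a : ι}
    (ha : a ∉ C) {l : ℕ} (hl : C.card ≤ 2 ^ l) : ∃ (c : Finset ι) (f : Equiv.Perm (ι → Fin 2)),
      c ⊆ insert a C ∧ (c.card = 0 ∨ c.card = 2) ∧
      Computes (insert a C) (825 * l + 345) (315 * C.card + 15) f ∧
      ∀ x, x a = 0 → ((∀ i ∈ c, f x i = 1) ↔ ∀ i ∈ C, x i = 1) := by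
  obtain h | h | h | h | h : C.card = 0 ∨ C.card = 1 ∨ C.card = 2 ∨ C.card = 3 ∨ 4 ≤ C.card := by
    omega
  · exact ⟨C, 1, Finset.subset_insert _ _, Or.inl h,
      (Computes.one _).mono le_rfl (Nat.zero_le _) (Nat.zero_le _), fun x _ => Iff.rfl⟩
  · have ht : Computes {a} 15 15 (toggle ∅ a) :=
      Computes.toggle_of_card_le_two (Finset.notMem_empty a) (by simp)
    refine ⟨insert a C, toggle ∅ a, le_rfl, Or.inr (by rw [Finset.card_insert_of_notMem ha, h]),
      ht.mono (by simp) (by omega) (by omega), fun x hx => ?_⟩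
    rw [Finset.forall_mem_insert, toggle_apply_self (Finset.notMem_empty a), hx]
    simp only [Finset.notMem_empty, false_imp_iff, implies_true, if_true, zero_add, true_and]
    exact forall₂_congr fun i hi => by rw [toggle_apply_of_ne _ (ne_of_mem_of_not_mem hi ha)]
  · exact ⟨C, 1, Finset.subset_insert _ _, Or.inr h,
      (Computes.one _).mono le_rfl (Nat.zero_le _) (Nat.zero_le _), fun x _ => Iff.rfl⟩
  · obtain ⟨e, c, hec, rfl, hc⟩ := Finset.card_eq_succ.1 h
    rw [Finset.mem_insert, not_or] at ha
    refine ⟨{a, e}, toggle c a, ?_, Or.inr (Finset.card_pair ha.1),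
      (Computes.toggle_of_card_le_two ha.2 hc.le).mono
        (Finset.insert_subset_insert _ (Finset.subset_insert _ _)) (by omega) (by omega),
      fun x hx => ?_⟩
    · exact Finset.insert_subset_insert _ (by simp)
    · rw [Finset.forall_mem_insert, Finset.forall_mem_insert, toggle_apply_self ha.2, hx, zero_add,
        and_comm]
      simp only [Finset.mem_singleton, forall_eq]
      rw [toggle_apply_of_ne _ (Ne.symm ha.1)]
      refine and_congr_right fun _ => ?_
      split_ifs with h2
      · exact iff_of_true rfl h2
      · exact iff_of_false (by decide) h2
  · obtain ⟨r, hr, f, hf, hspec⟩ := exists_conjunction ha h hl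
    refine ⟨{a, r}, f, ?_, Or.inr (Finset.card_pair fun h => ha (h ▸ hr)), hf, fun x hx => ?_⟩
    · exact Finset.insert_subset_insert _ (by simpa using hr)
    · rw [← hspec x hx]
      simp

theorem Realizes.controlled {ι : Type*} [Fintype ι] [DecidableEq ι] {c : Finset ι} {t : ι}
    (ht : t ∉ c) (hc : c.card = 0 ∨ c.card = 2) {U : Matrix (Fin 2) (Fin 2) ℂ}
    (hU : U ∈ Matrix.unitaryGroup (Fin 2) ℂ) :
    Realizes Finset.univ 15 15 (QCircuit.controlled c t U) := by
  rcases hc with hc | hc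
  · obtain rfl := Finset.card_eq_zero.1 hc
    exact (Realizes.single hU t).mono (Finset.subset_univ _) (by norm_num) (by norm_num)
  · obtain ⟨a, b, hab, rfl⟩ := Finset.card_eq_two.1 hc
    simp only [Finset.mem_insert, Finset.mem_singleton, not_or] at ht
    exact (Realizes.controlled_controlled hab (Ne.symm ht.1) (Ne.symm ht.2) hU).mono
      (Finset.subset_univ _) le_rfl le_rfl

theorem exists_implements_multiControlled (n : ℕ) {l : ℕ} (hl : n ≤ 2 ^ l)
    {U : Matrix (Fin 2) (Fin 2) ℂ} (hU : U ∈ Matrix.unitaryGroup (Fin 2) ℂ) :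
    ∃ C : Circuit (Fin (n + 1) ⊕ Fin 1), C.Implements (multiControlled n U) ∧
      C.depth ≤ 2 * (825 * l + 345) + 15 ∧ C.size ≤ 2 * (315 * n + 15) + 15 := by
  set B : Finset (Fin (n + 1) ⊕ Fin 1) :=
    (Finset.univ.erase (Fin.last n)).map Embedding.inl with hB
  have hBc : B.card = n := by simp [hB]
  have ha : (Sum.inr 0 : Fin (n + 1) ⊕ Fin 1) ∉ B := by simp [hB]
  have htB : (Sum.inl (Fin.last n) : Fin (n + 1) ⊕ Fin 1) ∉ insert (Sum.inr 0) B := by simp [hB]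
  obtain ⟨c, f, hc, hcc, hf, hspec⟩ := exists_conjunction_of_two ha (hBc.trans_le hl)
  rw [hBc] at hf
  have htc := fun h => htB (hc h)
  obtain ⟨C, -, hd, hs, hM⟩ := (hf.realizes.mono (Finset.subset_univ _) le_rfl le_rfl).mul
    ((Realizes.controlled htc hcc hU).mul
      (hf.inv.realizes.mono (Finset.subset_univ _) le_rfl le_rfl))
  refine ⟨C, fun ψ => funext fun y => ?_, hd.trans (by omega), hs.trans (by omega)⟩
  rw [hM, ← Matrix.mulVec_mulVec, ← Matrix.mulVec_mulVec, basisMatrix_mulVec, inv_inv,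
    controlled_mulVec htc]
  have hff : ∀ x, f⁻¹ (f x) = x := f.symm_apply_apply
  -- The target lies outside the support of `f`, so uncomputing after a change of the target
  -- restores every other qubit, including the ancilla.
  have hup : ∀ b, f⁻¹ (update (f y) (Sum.inl (Fin.last n)) b) =
      update y (Sum.inl (Fin.last n)) b := fun b => by
    rw [← hf.isLocal.apply_update htB, hff]
  simp only [basisMatrix_mulVec, hup, hff, hf.apply_of_notMem htB]
  by_cases hy : y (Sum.inr 0) = 0
  · rw [if_congr (hspec y hy) rfl rfl]
    have hw : ∀ (φ : (Fin (n + 1) → Fin 2) → ℂ) (z : Fin (n + 1) ⊕ Fin 1 → Fin 2),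
        z (Sum.inr 0) = 0 → withClean 1 φ z = φ fun i => z (Sum.inl i) := fun φ z hz =>
      if_pos fun k => by rw [Subsingleton.elim k 0]; exact hz
    rw [hw _ y hy, hw _ y hy, multiControlled, controlled_mulVec (Finset.notMem_erase _ _)]
    have hiff : (∀ i ∈ B, y i = 1) ↔
        ∀ i ∈ Finset.univ.erase (Fin.last n), y (Sum.inl i) = 1 := by
      rw [hB, Finset.forall_mem_map]
      rfl
    rw [if_congr hiff rfl rfl]
    congr 1
    refine Finset.sum_congr rfl fun b _ => ?_
    rw [hw _ _ (by rw [update_of_ne (by simp), hy])]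
    congr 2
    funext i
    by_cases hi : i = Fin.last n
    · subst hi; simp
    · rw [update_of_ne (by simpa using hi), update_of_ne hi]
  -- With the ancilla at 1 both amplitudes vanish, since changing the target does not change the
  -- ancilla.
  · have hw : ∀ (φ : (Fin (n + 1) → Fin 2) → ℂ) (z : Fin (n + 1) ⊕ Fin 1 → Fin 2),
        z (Sum.inr 0) ≠ 0 → withClean 1 φ z = 0 := fun φ z hz => if_neg fun h => hz (h 0)
    rw [hw _ y hy, hw _ y hy]
    have : ∀ b, withClean 1 ψ (update y (Sum.inl (Fin.last n)) b) = 0 := fun b =>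
      hw _ _ (by rw [update_of_ne (by simp)]; exact hy)
    simp [this]

end Implementation

end QCircuit


theorem mainTheorem5 :
    ∃ D S : ℕ → ℕ,
      (fun n => (D n : ℝ)) =O[atTop] (fun n : ℕ => Real.log (n : ℝ)) ∧
      (fun n => (S n : ℝ)) =O[atTop] (fun n : ℕ => (n : ℝ)) ∧
      ∀ (n : ℕ) (U : Matrix.unitaryGroup (Fin 2) ℂ),
        ∃ C : QCircuit.Circuit (Fin (n + 1) ⊕ Fin 1),
          C.Implements (QCircuit.multiControlled n (U : Matrix (Fin 2) (Fin 2) ℂ)) ∧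
          C.depth ≤ D n ∧ C.size ≤ S n := by
  refine ⟨fun n => 2 * (825 * (Nat.log 2 n + 1) + 345) + 15, fun n => 2 * (315 * n + 15) + 15,
    ?_, ?_, fun n U => QCircuit.exists_implements_multiControlled n
      (Nat.lt_pow_succ_log_self one_lt_two n).le U.2⟩
  · have h2 : 0 < Real.log 2 := Real.log_pos one_lt_two
    -- The depth bound is `1650 * Nat.log 2 n + 2355`, and `4005 = 1650 + 2355`; the constant term
    -- is absorbed because `log n ≥ log 2` for `n ≥ 2`.
    refine IsBigO.of_bound (4005 / Real.log 2) ?_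
    filter_upwards [eventually_ge_atTop 2] with n hn
    have hlog : Real.log 2 ≤ Real.log n := Real.log_le_log two_pos (by exact_mod_cast hn)
    have h1 : 1 ≤ Real.log n / Real.log 2 := (one_le_div h2).2 hlog
    have h3 : (Nat.log 2 n : ℝ) ≤ Real.log n / Real.log 2 := Real.natLog_le_logb n 2
    rw [Real.norm_of_nonneg (Nat.cast_nonneg _), Real.norm_of_nonneg (h2.le.trans hlog),
      div_mul_eq_mul_div, mul_div_assoc]
    push_cast
    linarith
  · refine IsBigO.of_bound 675 ?_
    filter_upwards [eventually_ge_atTop 1] with n hn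
    have h1 : (1 : ℝ) ≤ n := by exact_mod_cast hn
    rw [Real.norm_of_nonneg (Nat.cast_nonneg _), Real.norm_of_nonneg (Nat.cast_nonneg _)]
    push_cast
    linarith
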